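/- Let $M$ be an oriented matroid on a finite linearly ordered set $E$. For $A\subseteq E$ let $-_AM$ be the oriented matroid obtained from $M$ by reversing the signs of the elements of $A$; the reorientation $-_AM$ of $M$ is identified with the subset $A$, so that $M$ has $2^{|E|}$ reorientations. A circuit or cocircuit is positive if all signs of its elements are positive; below we identify it with its support. Let $a'_1<\dots<a'_\varepsilon$ be the active elements of $M$, i.e. the elements $\min(C)$ for $C$ a positive circuit of $M$, and let $a_1<\dots<a_\iota$ be the dual-active elements of $M$, i.e. the elements $\min(D)$ for $D$ a positive cocircuit of $M$. The active filtration of $M$ is the sequence of subsets $(F'_\varepsilon,\dots,F'_0,F_c,F_0,\dots,F_\iota)$, where $F_c$ is the union of all positive circuits of $M$, $F'_\varepsilon=\emptyset$, $F_\iota=E$, and $$F'_{k}=\bigcup_{\substack{C\text{ positive circuit}\\ \min(C)\ge a'_{k+1}}}C\quad(0\le k<\varepsilon),\qquad F_{k}=E\setminus\bigcup_{\substack{D\text{ positive cocircuit}\\ \min(D)\ge a_{k+1}}}D\quad(0\le k<\iota).$$ The active partition of $M$ consists of the parts $F'_{k-1}\setminus F'_k$ ($1\le k\le\varepsilon$)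 and $F_k\setminus F_{k-1}$ ($1\le k\le\iota$). The activity class of a reorientation $-_AM$ is the set of reorientations obtained from $-_AM$ by reorienting a union of parts of the active partition of $-_AM$. Then the active partition of $M$ is a partition of $E$ into nonempty parts, and reorienting all possible unions of parts of the active partition of $M$ gives exactly $2^{\iota+\varepsilon}$ reorientations of $M$. All of these have the same active filtration and the same active partition as $M$, and hence the same active elements and the same dual-active elements as $M$. Moreover, the activity classes of the reorientations of $M$ form a partition of the set of reorientations of $M$. -/

import Mathlib

/-- Two sign vectors (signed subsets) `X`, `Y` on `E` are orthogonal if their supports are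
disjoint, or if they agree in sign at some element of both supports and disagree in sign at
another one. -/
def SignOrthogonal {E : Type*} (X Y : E → SignType) : Prop :=
  (∀ e, X e * Y e = 0) ∨ ((∃ e, X e * Y e = 1) ∧ ∃ f, X f * Y f = -1)

/-- An oriented matroid with ground set `E` (to be used with `E` finite), given by its signed
circuits. The signed subset `(X⁺, X⁻)` is encoded as the sign vector `X : E → SignType` which is
`1` on `X⁺`, `-1` on `X⁻` and `0` elsewhere. -/
structure OrientedMatroid (E : Type*) where
  /-- The set of signed circuits. -/
  circuits : Set (E → SignType)
  zero_notMem : (0 : E → SignType) ∉ circuits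
  neg_mem : ∀ X ∈ circuits, -X ∈ circuits
  /-- Incomparability. -/
  incomparable : ∀ X ∈ circuits, ∀ Y ∈ circuits,
    Function.support X ⊆ Function.support Y → X = Y ∨ X = -Y
  /-- (Weak) circuit elimination. -/
  elimination : ∀ X ∈ circuits, ∀ Y ∈ circuits, X ≠ -Y → ∀ e, X e = 1 → Y e = -1 →
    ∃ Z ∈ circuits, Z e = 0 ∧ (∀ f, Z f = 1 → X f = 1 ∨ Y f = 1) ∧
      ∀ f, Z f = -1 → X f = -1 ∨ Y f = -1

/-- Change the signs of a sign vector on the elements of `A`. -/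
noncomputable def flipSigns {E : Type*} (A : Set E) (X : E → SignType) : E → SignType := by
  classical exact fun e => if e ∈ A then -X e else X e

theorem flipSigns_of_mem {E : Type*} {A : Set E} {e : E} (h : e ∈ A) (X : E → SignType) :
    flipSigns A X e = -X e := by
  simp [flipSigns, h]

theorem flipSigns_of_notMem {E : Type*} {A : Set E} {e : E} (h : e ∉ A) (X : E → SignType) :
    flipSigns A X e = X e := by
  simp [flipSigns, h]

theorem flipSigns_flipSigns {E : Type*} (A : Set E) (X : E → SignType) :
    flipSigns A (flipSigns A X) = X := by
  funext e
  by_cases h : e ∈ A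
  · rw [flipSigns_of_mem h, flipSigns_of_mem h, neg_neg]
  · rw [flipSigns_of_notMem h, flipSigns_of_notMem h]

theorem flipSigns_neg {E : Type*} (A : Set E) (X : E → SignType) :
    flipSigns A (-X) = -flipSigns A X := by
  funext e
  by_cases h : e ∈ A
  · simp [flipSigns_of_mem h]
  · simp [flipSigns_of_notMem h]

theorem support_flipSigns {E : Type*} (A : Set E) (X : E → SignType) :
    Function.support (flipSigns A X) = Function.support X := by
  ext e
  by_cases h : e ∈ A
  · simp only [Function.mem_support, flipSigns_of_mem h, ne_eq, SignType.neg_eq_zero_iff]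
  · simp only [Function.mem_support, flipSigns_of_notMem h]

namespace OrientedMatroid

/-- The reorientation `-_A M`: the signs of the elements of `A` are reversed in all circuits
(that is, `X` is a circuit of `-_A M` iff `X` with signs reversed on `A` is a circuit of `M`). -/
noncomputable def reorient {E : Type*} (M : OrientedMatroid E) (A : Set E) :
    OrientedMatroid E where
  circuits := {X | flipSigns A X ∈ M.circuits}
  zero_notMem := by
    intro h
    have h0 : flipSigns A (0 : E → SignType) = 0 := by
      funext e
      by_cases he : e ∈ A
      · simp [flipSigns_of_mem he]
      · simp [flipSigns_of_notMem he]
    rw [Set.mem_ofPred_eq, h0] at h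
    exact M.zero_notMem h
  neg_mem := by
    intro X hX
    rw [Set.mem_ofPred_eq, flipSigns_neg]
    exact M.neg_mem _ hX
  incomparable := by
    intro X hX Y hY hXY
    have h := M.incomparable _ hX _ hY (by rwa [support_flipSigns, support_flipSigns])
    rcases h with h | h
    · left
      rw [← flipSigns_flipSigns A X, h, flipSigns_flipSigns]
    · right
      rw [← flipSigns_flipSigns A X, h, flipSigns_neg, flipSigns_flipSigns]
  elimination := by
    intro X hX Y hY hne e hXe hYe
    have hne' : flipSigns A X ≠ -flipSigns A Y := by
      intro h
      apply hne
      rw [← flipSigns_flipSigns A X, h, flipSigns_neg, flipSigns_flipSigns]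
    have key : ∃ Z ∈ M.circuits, Z e = 0 ∧
        (∀ f, Z f = 1 → flipSigns A X f = 1 ∨ flipSigns A Y f = 1) ∧
        ∀ f, Z f = -1 → flipSigns A X f = -1 ∨ flipSigns A Y f = -1 := by
      by_cases he : e ∈ A
      · have hne'' : flipSigns A Y ≠ -flipSigns A X := by
          intro h
          apply hne'
          rw [h, neg_neg]
        obtain ⟨Z, hZ, h0, h1, h2⟩ := M.elimination _ hY _ hX hne'' e
          (by rw [flipSigns_of_mem he, hYe]; rfl) (by rw [flipSigns_of_mem he, hXe])
        exact ⟨Z, hZ, h0, fun f hf => (h1 f hf).symm, fun f hf => (h2 f hf).symm⟩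
      · exact M.elimination _ hX _ hY hne' e
          (by rw [flipSigns_of_notMem he, hXe]) (by rw [flipSigns_of_notMem he, hYe])
    obtain ⟨Z, hZ, h0, h1, h2⟩ := key
    refine ⟨flipSigns A Z, ?_, ?_, ?_, ?_⟩
    · rw [Set.mem_ofPred_eq, flipSigns_flipSigns]
      exact hZ
    · by_cases he : e ∈ A
      · simp [flipSigns_of_mem he, h0]
      · simp [flipSigns_of_notMem he, h0]
    · intro f hf
      by_cases hfA : f ∈ A
      · rw [flipSigns_of_mem hfA, neg_eq_iff_eq_neg] at hf
        simpa [flipSigns_of_mem hfA] using h2 f hf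
      · rw [flipSigns_of_notMem hfA] at hf
        simpa [flipSigns_of_notMem hfA] using h1 f hf
    · intro f hf
      by_cases hfA : f ∈ A
      · rw [flipSigns_of_mem hfA, neg_inj] at hf
        have := h1 f hf
        rw [flipSigns_of_mem hfA, flipSigns_of_mem hfA] at this
        rcases this with h | h
        · left; rw [← h, neg_neg]
        · right; rw [← h, neg_neg]
      · rw [flipSigns_of_notMem hfA] at hf
        simpa [flipSigns_of_notMem hfA] using h2 f hf

/-- The signed cocircuits of `M`: the sign vectors of inclusion-minimal support among the nonzero
sign vectors orthogonal to all circuits of `M`. -/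
def cocircuits {E : Type*} (M : OrientedMatroid E) : Set (E → SignType) :=
  {Y | Y ≠ 0 ∧ (∀ X ∈ M.circuits, SignOrthogonal X Y) ∧
    ∀ Z : E → SignType, Z ≠ 0 → (∀ X ∈ M.circuits, SignOrthogonal X Z) →
      Function.support Z ⊆ Function.support Y → Function.support Z = Function.support Y}

/-- `C` is (the support of) a positive circuit of `M`. -/
def IsPositiveCircuit {E : Type*} (M : OrientedMatroid E) (C : Set E) : Prop :=
  ∃ X ∈ M.circuits, (∀ e, 0 ≤ X e) ∧ Function.support X = C

/-- `D` is (the support of) a positive cocircuit of `M`. -/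
def IsPositiveCocircuit {E : Type*} (M : OrientedMatroid E) (D : Set E) : Prop :=
  ∃ Y ∈ M.cocircuits, (∀ e, 0 ≤ Y e) ∧ Function.support Y = D

/-- `O(M)`, the set of active elements: the minima of the positive circuits. -/
def activeElements {E : Type*} [LinearOrder E] (M : OrientedMatroid E) : Set E :=
  {a | ∃ C, M.IsPositiveCircuit C ∧ IsLeast C a}

/-- `O*(M)`, the set of dual-active elements: the minima of the positive cocircuits. -/
def dualActiveElements {E : Type*} [LinearOrder E] (M : OrientedMatroid E) : Set E :=
  {a | ∃ D, M.IsPositiveCocircuit D ∧ IsLeast D a}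

/-- The union of the positive circuits of `M` all of whose elements are `≥ a`. -/
def circuitUnionGE {E : Type*} [LinearOrder E] (M : OrientedMatroid E) (a : E) : Set E :=
  ⋃₀ {C | M.IsPositiveCircuit C ∧ ∀ e ∈ C, a ≤ e}

/-- The union of the positive cocircuits of `M` all of whose elements are `≥ a`. -/
def cocircuitUnionGE {E : Type*} [LinearOrder E] (M : OrientedMatroid E) (a : E) : Set E :=
  ⋃₀ {D | M.IsPositiveCocircuit D ∧ ∀ e ∈ D, a ≤ e}

end OrientedMatroid

/-- The elements of a set in a finite linear order, listed in increasing order. -/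
noncomputable def sortedElements {E : Type*} [Fintype E] [LinearOrder E] (S : Set E) : List E :=
  S.toFinite.toFinset.sort (· ≤ ·)

/-- The data of a sequence of subsets `(F'_ε, …, F'_0, F_c, F_0, …, F_ι)` of `E`. -/
@[ext]
structure FiltrationData (E : Type*) where
  /-- The list `F'_0, F'_1, …, F'_ε`. -/
  lower : List (Set E)
  /-- The set `F_c`. -/
  cyclicFlat : Set E
  /-- The list `F_0, F_1, …, F_ι`. -/
  upper : List (Set E)

namespace OrientedMatroid

/-- The active filtration of an ordered oriented matroid. With active elements
`a'_1 < … < a'_ε` and dual-active elements `a_1 < … < a_ι`: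
`F'_{k-1}` is the union of the positive circuits with minimum `≥ a'_k`, and `F'_ε = ∅`;
`F_c` is the union of all positive circuits;
`F_{k-1}` is the complement of the union of the positive cocircuits with minimum `≥ a_k`, and
`F_ι = E`. -/
noncomputable def activeFiltration {E : Type*} [Fintype E] [LinearOrder E]
    (M : OrientedMatroid E) : FiltrationData E where
  lower := (sortedElements M.activeElements).map (fun a => M.circuitUnionGE a) ++ [∅]
  cyclicFlat := ⋃₀ {C | M.IsPositiveCircuit C}
  upper := (sortedElements M.dualActiveElements).map (fun a => (M.cocircuitUnionGE a)ᶜ) ++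
    [Set.univ]

/-- The active partition of an ordered oriented matroid, as the set of its parts, which are the
successive differences `F'_{k-1} \ F'_k` (`1 ≤ k ≤ ε`) and `F_k \ F_{k-1}` (`1 ≤ k ≤ ι`) of the
active filtration. -/
def activePartition {E : Type*} [Fintype E] [LinearOrder E] (M : OrientedMatroid E) :
    Set (Set E) :=
  {P | (∃ (k : ℕ) (F G : Set E), M.activeFiltration.lower[k]? = some F ∧
          M.activeFiltration.lower[k + 1]? = some G ∧ P = F \ G) ∨
       (∃ (k : ℕ) (F G : Set E), M.activeFiltration.upper[k]? = some F ∧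
          M.activeFiltration.upper[k + 1]? = some G ∧ P = G \ F)}

/-- The unions of parts of the active partition of `M`. -/
def activeUnions {E : Type*} [Fintype E] [LinearOrder E] (M : OrientedMatroid E) : Set (Set E) :=
  {A | ∃ S ⊆ M.activePartition, A = ⋃₀ S}

/-- A reorientation `-_A M` of `M` is identified with the subset `A`. The activity class of the
reorientation `-_A M` is the set of reorientations of `M` obtained by reorienting, in `-_A M`, a
union `B` of parts of the active partition of `-_A M`; reorienting `B` in `-_A M` gives the
reorientation of `M` identified with the symmetric difference of `A` and `B`. -/
def activityClass {E : Type*} [Fintype E] [LinearOrder E] (M : OrientedMatroid E) (A : Set E) :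
    Set (Set E) :=
  {A' | ∃ B ∈ (M.reorient A).activeUnions, A' = symmDiff A B}

end OrientedMatroid

/-! For an element a let U(a) be the union of the positive circuits contained in [a, ∞), and U*(a)
the analogous union for cocircuits. Active elements, filtration and partition depend only on these
two families (`SameUnions`): for instance, a is active iff a ∈ U(a). So it suffices that reorienting
a union of parts leaves both families unchanged.

Reorient U(a). A positive circuit of the result is, up to signs in U(a), a circuit X of M that is
nonnegative off U(a). Eliminating its negative elements against positive circuits inside U(a) gives
positive circuits of M, through any chosen element of X, inside U(a) ∪ supp X
(`exists_isPositiveCircuit_of_nonneg_off`). Comparing a with b then shows that every U(b) is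
preserved (`circuitUnionGE_reorient`). Positive cocircuits are disjoint from positive circuits, so
the U*(b) do not change either. Duality handles U*(a). Each part is some U(a) or U(a) \ U(b) with
U(b) ⊆ U(a), or the dual of these, so unions of parts are reached by successive reorientations of
such sets (`sameUnions_of_mem_activeUnions`).

The parts cover E because each element lies in a positive circuit or a positive cocircuit. This, and
the fact that cocircuits form an oriented matroid, are derived from weak circuit elimination through
strong elimination, the painting lemma and covector elimination. The count follows since distinct
families of parts have distinct unions. The activity classes partition because unions of parts are
closed under symmetric difference. -/

/-! ### Signs and finite descent -/

/-- Every sign of `Z` is zero or is inherited from `X` or from `Y`. -/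
def SignBetween {E : Type*} (X Y Z : E → SignType) : Prop :=
  ∀ h, Z h = 0 ∨ Z h = X h ∨ Z h = Y h

theorem SignBetween.eq_one {E : Type*} {X Y Z : E → SignType} (hb : SignBetween X Y Z) {h : E}
    (hh : Z h = 1) : X h = 1 ∨ Y h = 1 := by
  rcases hb h with h0 | h0 | h0
  · simp [h0] at hh
  · exact Or.inl (h0 ▸ hh)
  · exact Or.inr (h0 ▸ hh)

theorem SignBetween.eq_neg_one {E : Type*} {X Y Z : E → SignType} (hb : SignBetween X Y Z) {h : E}
    (hh : Z h = -1) : X h = -1 ∨ Y h = -1 := by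
  rcases hb h with h0 | h0 | h0
  · simp [h0] at hh
  · exact Or.inl (h0 ▸ hh)
  · exact Or.inr (h0 ▸ hh)

theorem SignType.eq_neg_of_ne {x y : SignType} (hx : x ≠ 0) (hy : y ≠ 0) (h : x ≠ y) :
    x = -y := by
  revert x y; decide

theorem SignType.neg_ne_self {x : SignType} (hx : x ≠ 0) : -x ≠ x := by
  revert x; decide

/-- Drives the one-element-at-a-time repairs below: wrong signs, separating elements and negative
elements are each removed by a single elimination. -/
theorem exists_eq_empty_of_ssubset_step {α ι : Type*} [Finite ι] {P : α → Prop} (bad : α → Set ι)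
    (step : ∀ w, P w → ∀ h ∈ bad w, ∃ z, P z ∧ bad z ⊂ bad w) (w : α) (hw : P w) :
    ∃ z, P z ∧ bad z = ∅ := by
  induction hn : (bad w).ncard using Nat.strong_induction_on generalizing w with
  | _ n ih =>
    rcases (bad w).eq_empty_or_nonempty with h | ⟨h, hh⟩
    · exact ⟨w, hw, h⟩
    · obtain ⟨z, hz, hlt⟩ := step w hw h hh
      exact ih _ (hn ▸ Set.ncard_lt_ncard hlt) z hz rfl

theorem ncard_support_union_lt {E : Type*} [Finite E] {A B A' B' : E → SignType} (x : E)
    (hx : A' x ≠ 0 ∨ B' x ≠ 0) (hA : A x = 0) (hB : B x = 0)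
    (hsub : ∀ h, A' h = 0 → B' h = 0 → A h = 0 ∧ B h = 0) :
    (Function.support A ∪ Function.support B).ncard <
      (Function.support A' ∪ Function.support B').ncard := by
  refine Set.ncard_lt_ncard ?_ (Set.toFinite _)
  refine (Set.ssubset_iff_of_subset ?_).2 ⟨x, ?_, ?_⟩
  · intro h hh
    by_contra hc
    simp only [Set.mem_union, Function.mem_support, not_or, not_not] at hh hc
    have := hsub h hc.1 hc.2
    simp [this] at hh
  · simpa using hx
  · simp [hA, hB]

/-! ### Strong circuit elimination -/

namespace OrientedMatroid

variable {E : Type*} (M : OrientedMatroid E)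

theorem weak_elimination {X Y : E → SignType} (hX : X ∈ M.circuits) (hY : Y ∈ M.circuits)
    (hXY : X ≠ -Y) {k : E} (hk : X k = -Y k) (hk0 : X k ≠ 0) :
    ∃ Z ∈ M.circuits, Z k = 0 ∧ SignBetween X Y Z := by
  have key : ∀ X Y : E → SignType, X ∈ M.circuits → Y ∈ M.circuits → X ≠ -Y → X k = 1 →
      Y k = -1 → ∃ Z ∈ M.circuits, Z k = 0 ∧ SignBetween X Y Z := by
    intro X Y hX hY hXY h1 h2
    obtain ⟨Z, hZ, hZk, hp, hn⟩ := M.elimination X hX Y hY hXY k h1 h2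
    refine ⟨Z, hZ, hZk, fun h => ?_⟩
    have hp := hp h
    have hn := hn h
    generalize Z h = z at *
    generalize X h = x at *
    generalize Y h = y at *
    revert hp hn
    clear * -
    revert x y z
    decide
  rcases SignType.trichotomy (X k) with h | h | h
  · obtain ⟨Z, hZ, hZk, hb⟩ := key Y X hY hX (fun h' => hXY (by rw [h', neg_neg]))
      (by rw [h, eq_comm, neg_eq_iff_eq_neg, neg_neg] at hk; exact hk) h
    exact ⟨Z, hZ, hZk, fun h => (hb h).imp id Or.symm⟩
  · exact absurd h hk0
  · exact key X Y hX hY hXY h (by rw [← neg_neg (Y k), ← hk, h])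

theorem exists_ne_zero_of_eq_zero {X Z : E → SignType} (hX : X ∈ M.circuits)
    (hZ : Z ∈ M.circuits) {k : E} (hXk : X k ≠ 0) (hZk : Z k = 0) : ∃ g, Z g ≠ 0 ∧ X g = 0 := by
  by_contra hc
  push Not at hc
  rcases M.incomparable Z hZ X hX hc with h | h <;> simp [h] at hZk <;> exact hXk hZk

/-- The last step of strong elimination: signs of `W` inherited from `-D`, where `D` is between
`X` and `Y`, are removed by successive eliminations with `D`. -/
theorem exists_signBetween_of_repair [Finite E] {X Y D W : E → SignType} {k f : E}
    (hDk : D k = 0) (hXYk : X k ≠ 0 ∨ Y k ≠ 0) (hDb : SignBetween X Y D)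
    (elim : ∀ {W : E → SignType} {h : E}, W ∈ M.circuits →
      (Function.support W ∪ Function.support D).ncard <
        (Function.support X ∪ Function.support Y).ncard →
      W h = -D h → W h ≠ 0 → W f ≠ 0 →
      ∃ Z ∈ M.circuits, Z h = 0 ∧ Z f = W f ∧ SignBetween W D Z)
    (hW : W ∈ M.circuits) (hWk : W k = 0) (hWf : W f ≠ 0)
    (hWb : ∀ h, (W h = 0 ∨ W h = X h ∨ W h = Y h) ∨ W h = -D h) :
    ∃ Z ∈ M.circuits, Z k = 0 ∧ Z f = W f ∧ SignBetween X Y Z := by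
  have step : ∀ V : E → SignType, (V ∈ M.circuits ∧ V k = 0 ∧ V f = W f ∧
      ∀ h, (V h = 0 ∨ V h = X h ∨ V h = Y h) ∨ V h = -D h) →
      ∀ h ∈ {h | ¬ (V h = 0 ∨ V h = X h ∨ V h = Y h)},
      ∃ Z : E → SignType, (Z ∈ M.circuits ∧ Z k = 0 ∧ Z f = W f ∧
        ∀ h, (Z h = 0 ∨ Z h = X h ∨ Z h = Y h) ∨ Z h = -D h) ∧
        {h | ¬ (Z h = 0 ∨ Z h = X h ∨ Z h = Y h)} ⊂
          {h | ¬ (V h = 0 ∨ V h = X h ∨ V h = Y h)} := by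
    rintro V ⟨hV, hVk, hVf, hVb⟩ h hh
    have hVh : V h = -D h := (hVb h).resolve_left hh
    have hV0 : V h ≠ 0 := fun h0 => hh (Or.inl h0)
    have hlt : (Function.support V ∪ Function.support D).ncard <
        (Function.support X ∪ Function.support Y).ncard := by
      refine ncard_support_union_lt k hXYk hVk hDk fun j hXj hYj => ?_
      have hDj : D j = 0 := by have := hDb j; grind
      have := hVb j
      simp only [hXj, hYj, hDj, neg_zero, or_self] at this
      exact ⟨this, hDj⟩
    obtain ⟨Z, hZ, hZh, hZf, hZb⟩ := elim hV hlt hVh hV0 (hVf ▸ hWf)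
    refine ⟨Z, ⟨hZ, ?_, hZf.trans hVf, fun j => ?_⟩, ?_⟩
    · have := hZb k; grind
    · have h1 := hZb j
      have h2 := hDb j
      have h3 := hVb j
      grind
    · refine (Set.ssubset_iff_of_subset fun j hj => ?_).2 ⟨h, hh, fun hc => hc (Or.inl hZh)⟩
      have h1 := hZb j
      have h2 := hDb j
      have h3 := hVb j
      simp only [Set.mem_ofPred_eq] at hj ⊢
      grind
  obtain ⟨Z, ⟨hZ, hZk, hZf, -⟩, hZb⟩ := exists_eq_empty_of_ssubset_step _ step W
    ⟨hW, hWk, rfl, hWb⟩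
  refine ⟨Z, hZ, hZk, hZf, fun h => ?_⟩
  by_contra hc
  exact (Set.eq_empty_iff_forall_notMem.1 hZb h) hc

/-- Induction on the size of the joint support. If the weakly eliminated circuit `D` loses `f`, it
has an element `g` outside `X`. Eliminating `g` between `Y` and `-D` keeps `k`, as `D k = 0`; the
result `Y'` is then eliminated against `X` at `k`. The first joint support misses `f`, the second
misses `g`. Signs inherited from `-D` are repaired against `D`, with joint supports missing `k`. -/
theorem strong_elimination_of_eq_zero [Finite E] {X Y : E → SignType} (hX : X ∈ M.circuits)
    (hY : Y ∈ M.circuits) {k f : E} (hk : X k = -Y k) (hk0 : X k ≠ 0) (hf : X f ≠ 0)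
    (hYf : Y f = 0) :
    ∃ Z ∈ M.circuits, Z k = 0 ∧ Z f = X f ∧ SignBetween X Y Z := by
  induction hn : (Function.support X ∪ Function.support Y).ncard using Nat.strong_induction_on
    generalizing X Y k f with
  | _ n ih =>
    subst hn
    have hYk0 : Y k ≠ 0 := fun h => hk0 (by simp [hk, h])
    obtain ⟨D, hD, hDk, hDb⟩ := M.weak_elimination hX hY
      (fun h => hf (by simp [h, hYf])) hk hk0
    by_cases hDf : D f = 0
    swap
    · refine ⟨D, hD, hDk, ?_, hDb⟩
      have := hDb f
      grind
    obtain ⟨g, hDg, hXg⟩ := M.exists_ne_zero_of_eq_zero hX hD hk0 hDk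
    have hDgY : D g = Y g := by have := hDb g; grind
    obtain ⟨Y', hY', hY'g, hY'k, hY'b⟩ := ih _
      (ncard_support_union_lt (A := Y) (B := -D) f (Or.inl hf) hYf (by simp [hDf])
        fun h h1 h2 => ⟨h2, by have := hDb h; simp only [Pi.neg_apply]; grind [neg_zero]⟩)
      hY (M.neg_mem D hD) (k := g) (f := k) (by simp [hDgY]) (hDgY ▸ hDg) hYk0
      (by simp [hDk]) rfl
    have hY'0 : ∀ h, Y h = 0 → D h = 0 → Y' h = 0 := by
      intro h h1 h2
      simpa [h1, h2] using hY'b h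
    obtain ⟨W, hW, hWk, hWf, hWb⟩ := ih _
      (ncard_support_union_lt (A := X) (B := Y') g (Or.inr (hDgY ▸ hDg)) hXg hY'g
        fun h h1 h2 => ⟨h1, hY'0 h h2 (by have := hDb h; grind)⟩)
      hX hY' (k := k) (f := f) (by rw [hk, hY'k]) hk0 hf (hY'0 f hYf hDf) rfl
    rw [← hWf]
    refine M.exists_signBetween_of_repair hDk (Or.inl hk0) hDb
      (fun hV hlt h1 h2 h3 => ih _ hlt hV hD h1 h2 h3 hDf rfl) hW hWk (hWf ▸ hf) fun h => ?_
    have h1 := hWb h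
    have h2 := hY'b h
    simp only [Pi.neg_apply] at h2
    grind

/-- In the remaining case `X f = Y f`, the circuit `Y'` is made to keep `f` rather than `k`. If it
loses `k`, it can be repaired directly, without `X`. -/
theorem strong_elimination [Finite E] {X Y : E → SignType} (hX : X ∈ M.circuits)
    (hY : Y ∈ M.circuits) {k f : E} (hk : X k = -Y k) (hk0 : X k ≠ 0) (hf : X f ≠ 0)
    (hYf : X f ≠ -Y f) :
    ∃ Z ∈ M.circuits, Z k = 0 ∧ Z f = X f ∧ SignBetween X Y Z := by
  induction hn : (Function.support X ∪ Function.support Y).ncard using Nat.strong_induction_on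
    generalizing X Y k f with
  | _ n ih =>
    subst hn
    by_cases hYf0 : Y f = 0
    · exact M.strong_elimination_of_eq_zero hX hY hk hk0 hf hYf0
    have hXYf : X f = Y f := by
      by_contra h
      exact hYf (SignType.eq_neg_of_ne hf hYf0 h)
    obtain ⟨D, hD, hDk, hDb⟩ := M.weak_elimination hX hY (fun h => hYf (by simp [h])) hk hk0
    by_cases hDf : D f = 0
    swap
    · refine ⟨D, hD, hDk, ?_, hDb⟩
      have := hDb f
      grind
    obtain ⟨g, hDg, hXg⟩ := M.exists_ne_zero_of_eq_zero hX hD hk0 hDk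
    have hDgY : D g = Y g := by have := hDb g; grind
    have repair : ∀ {W : E → SignType}, W ∈ M.circuits → W k = 0 → W f = X f →
        (∀ h, (W h = 0 ∨ W h = X h ∨ W h = Y h) ∨ W h = -D h) →
        ∃ Z ∈ M.circuits, Z k = 0 ∧ Z f = X f ∧ SignBetween X Y Z := by
      intro W hW hWk hWf hWb
      rw [← hWf]
      exact M.exists_signBetween_of_repair hDk (Or.inl hk0) hDb
        (fun hV _ h1 h2 h3 => M.strong_elimination_of_eq_zero hV hD h1 h2 h3 hDf)
        hW hWk (hWf ▸ hf) hWb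
    obtain ⟨Y', hY', hY'g, hY'f, hY'b⟩ := M.strong_elimination_of_eq_zero
      hY (M.neg_mem D hD) (k := g) (f := f) (by simp [hDgY]) (hDgY ▸ hDg) hYf0
      (by simp [hDf])
    simp only [SignBetween, Pi.neg_apply] at hY'b
    by_cases hY'k : Y' k = 0
    · exact repair hY' hY'k (hY'f.trans hXYf.symm) fun h => by have := hY'b h; grind
    have hY'k' : Y' k = Y k := by have := hY'b k; grind [neg_zero]
    obtain ⟨W, hW, hWk, hWf, hWb⟩ := ih _
      (ncard_support_union_lt (A := X) (B := Y') g (Or.inr (hDgY ▸ hDg)) hXg hY'g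
        fun h h1 h2 => ⟨h1, by have := hDb h; have := hY'b h; grind [neg_zero]⟩)
      hX hY' (k := k) (f := f) (by rw [hk, hY'k']) hk0 hf (by rw [hY'f]; exact hYf) rfl
    refine repair hW hWk hWf fun h => ?_
    have h1 := hWb h
    have h2 := hY'b h
    grind

end OrientedMatroid

/-! ### Orthogonality, covectors and painting -/

theorem SignOrthogonal.exists_eq_neg_one {E : Type*} {X Y : E → SignType}
    (h : SignOrthogonal X Y) {e : E} (he : X e * Y e = 1) : ∃ f, X f * Y f = -1 := by
  rcases h with h | h
  · simp [h e] at he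
  · exact h.2

theorem signOrthogonal_of_forall {E : Type*} {X Y : E → SignType}
    (h1 : ∀ e, X e * Y e = 1 → ∃ f, X f * Y f = -1)
    (h2 : ∀ e, X e * Y e = -1 → ∃ f, X f * Y f = 1) : SignOrthogonal X Y := by
  by_cases h : ∀ e, X e * Y e = 0
  · exact Or.inl h
  · push Not at h
    obtain ⟨e, he⟩ := h
    rcases SignType.trichotomy (X e * Y e) with h | h | h
    · exact Or.inr ⟨h2 e h, e, h⟩
    · exact absurd h he
    · exact Or.inr ⟨⟨e, h⟩, h1 e h⟩

/-- The composition of sign vectors. -/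
def signComp {E : Type*} (X Y : E → SignType) : E → SignType :=
  fun e => if X e = 0 then Y e else X e

theorem signComp_neg {E : Type*} (X Y : E → SignType) :
    signComp (-X) (-Y) = -signComp X Y := by
  funext e
  simp only [signComp, Pi.neg_apply, SignType.neg_eq_zero_iff]
  split_ifs <;> rfl

namespace OrientedMatroid

variable {E : Type*} (M : OrientedMatroid E)

/-- The sign vectors orthogonal to all circuits. -/
def covectors : Set (E → SignType) := {Y | ∀ X ∈ M.circuits, SignOrthogonal X Y}

theorem neg_mem_covectors {Y : E → SignType} (hY : Y ∈ M.covectors) : -Y ∈ M.covectors := by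
  intro X hX
  have := hY X hX
  unfold SignOrthogonal at *
  simpa [neg_eq_iff_eq_neg, and_comm] using this

theorem signComp_mem_covectors {Y Z : E → SignType} (hY : Y ∈ M.covectors)
    (hZ : Z ∈ M.covectors) : signComp Y Z ∈ M.covectors := by
  intro X hX
  rcases hY X hX with h | ⟨⟨e, he⟩, f, hf⟩
  · have h' : ∀ e, X e * signComp Y Z e = X e * Z e := by
      intro e
      rcases mul_eq_zero.1 (h e) with h | h <;> simp [signComp, h]
    have := hZ X hX
    unfold SignOrthogonal at *
    simpa only [h'] using this
  · refine Or.inr ⟨⟨e, ?_⟩, f, ?_⟩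
    · have : Y e ≠ 0 := fun h => by simp [h] at he
      simpa [signComp, this] using he
    · have : Y f ≠ 0 := fun h => by simp [h] at hf
      simpa [signComp, this] using hf

/-- The painting lemma. -/
theorem exists_covector_of_forall_circuit [Finite E] (A N : Set E) {e : E}
    (heA : e ∈ A) (heN : e ∉ N)
    (hAN : ∀ X ∈ M.circuits, (∀ h, X h = 1 → h ∈ A) → (∀ h, X h = -1 → h ∈ N) → X e ≠ 1) :
    ∃ Y ∈ M.covectors, Y e = 1 ∧ (∀ h ∈ A, 0 ≤ Y h) ∧ ∀ h ∈ N, Y h ≤ 0 := by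
  classical
  -- Enlarging to a maximal pair only strengthens the demands on `Y`. Maximality gives, for every
  -- single addition, a circuit positive at `e` that uses the added element.
  obtain ⟨⟨A', N'⟩, hle, hmax⟩ := (Set.toFinite {p : Set E × Set E | e ∉ p.2 ∧ ∀ X ∈ M.circuits,
    (∀ h, X h = 1 → h ∈ p.1) → (∀ h, X h = -1 → h ∈ p.2) → X e ≠ 1}).exists_le_maximal
    (show (A, N) ∈ _ from ⟨heN, hAN⟩)
  obtain ⟨⟨heN', hblock⟩, hmax⟩ := hmax
  simp only at heN' hblock
  have hA' : ∀ k ∉ A', ∃ X ∈ M.circuits, (∀ h, X h = 1 → h = k ∨ h ∈ A') ∧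
      (∀ h, X h = -1 → h ∈ N') ∧ X e = 1 ∧ X k = 1 := by
    intro k hk
    by_contra hc
    push Not at hc
    refine hk ((hmax (y := (insert k A', N')) ⟨heN', fun X hX h1 h2 h3 => ?_⟩
      ⟨Set.subset_insert _ _, le_rfl⟩).1 (Set.mem_insert _ _))
    have hXk := hc X hX h1 h2 h3
    exact hblock X hX (fun h hh => (h1 h hh).resolve_left fun h' => hXk (h' ▸ hh)) h2 h3
  have hN' : ∀ k ∉ N', k ≠ e → ∃ X ∈ M.circuits, (∀ h, X h = 1 → h ∈ A') ∧
      (∀ h, X h = -1 → h = k ∨ h ∈ N') ∧ X e = 1 ∧ X k = -1 := by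
    intro k hk hke
    by_contra hc
    push Not at hc
    refine hk ((hmax (y := (A', insert k N')) ⟨?_, fun X hX h1 h2 h3 => ?_⟩
      ⟨le_rfl, Set.subset_insert _ _⟩).2 (Set.mem_insert _ _))
    · simp only [Set.mem_insert_iff, not_or]
      exact ⟨hke.symm, heN'⟩
    · have hXk := hc X hX h1 h2 h3
      exact hblock X hX h1 (fun h hh => (h2 h hh).resolve_left fun h' => hXk (h' ▸ hh)) h3
  -- If neither addition of `k` is allowed, the two witnessing circuits are opposite at `k` and
  -- agree at `e`; eliminating `k` gives a forbidden circuit.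
  have hcover : ∀ k, k ≠ e → k ∈ A' ∨ k ∈ N' := by
    intro k hke
    by_contra hc
    rw [not_or] at hc
    obtain ⟨X, hX, hX1, hX2, hXe, hXk⟩ := hA' k hc.1
    obtain ⟨Y, hY, hY1, hY2, hYe, hYk⟩ := hN' k hc.2 hke
    obtain ⟨Z, hZ, hZk, hZe, hZb⟩ := M.strong_elimination hX hY (k := k) (f := e)
      (by rw [hXk, hYk, neg_neg]) (by simp [hXk]) (by simp [hXe])
      (by rw [hXe, hYe]; decide)
    have hZk' : ∀ s : SignType, s ≠ 0 → ∀ h, Z h = s → h ≠ k := by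
      rintro s hs h hh rfl
      exact hs (hh ▸ hZk)
    refine hblock Z hZ (fun h hh => ?_) (fun h hh => ?_) (hZe.trans hXe)
    · exact (hZb.eq_one hh).elim
        (fun h' => (hX1 h h').resolve_left (hZk' 1 (by decide) h hh)) (hY1 h)
    · exact (hZb.eq_neg_one hh).elim (hX2 h)
        (fun h' => (hY2 h h').resolve_left (hZk' (-1) (by decide) h hh))
  let Y : E → SignType := fun h =>
    if h = e then 1 else if h ∈ A' then (if h ∈ N' then 0 else 1) else -1
  have hYe : Y e = 1 := by simp [Y]
  have hY1 : ∀ h, Y h = 1 → h ≠ e → h ∈ A' ∧ h ∉ N' := by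
    intro h hh he
    simp only [Y, if_neg he] at hh
    split_ifs at hh with h1 h2
    exact ⟨h1, h2⟩
  have hY2 : ∀ h, Y h = -1 → h ≠ e ∧ h ∈ N' ∧ h ∉ A' := by
    intro h hh
    have he : h ≠ e := by rintro rfl; simp [hYe] at hh
    simp only [Y, if_neg he] at hh
    split_ifs at hh with h1 h2
    exact ⟨he, (hcover h he).resolve_left h1, h1⟩
  have hYA : ∀ h ∈ A', 0 ≤ Y h := by
    intro h hh
    rcases SignType.trichotomy (Y h) with h0 | h0 | h0
    · exact absurd hh (hY2 h h0).2.2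
    · rw [h0]
    · rw [h0]; decide
  have hYN : ∀ h ∈ N', Y h ≤ 0 := by
    intro h hh
    rcases SignType.trichotomy (Y h) with h0 | h0 | h0
    · rw [h0]; decide
    · rw [h0]
    · exact absurd hh (hY1 h h0 (by rintro rfl; exact heN' hh)).2
  -- A violating `X` obeys the pattern `(A', N')` off `e`, which forces `X e = 0`. Eliminating `k`
  -- between `X` and the circuit that maximality attaches to `k` keeps `e` and is forbidden.
  have main : ∀ X ∈ M.circuits, ∀ k, X k * Y k = 1 → ∃ f, X f * Y f = -1 := by
    intro X hX k hk
    by_contra hc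
    push Not at hc
    have hp : ∀ h, h ≠ e → X h = 1 → h ∈ A' := by
      intro h he hh
      rcases hcover h he with h1 | h1
      · exact h1
      · by_contra h2
        have : Y h = -1 := by simp [Y, he, h2]
        exact hc h (by rw [hh, this, one_mul])
    have hn : ∀ h, h ≠ e → X h = -1 → h ∈ N' := by
      intro h he hh
      by_contra h2
      have : Y h = 1 := by simp [Y, he, (hcover h he).resolve_right h2, h2]
      exact hc h (by rw [hh, this, mul_one])
    have hXe1 : X e ≠ -1 := fun h => hc e (by rw [h, hYe, mul_one])
    have hXe : X e = 0 := by
      rcases SignType.trichotomy (X e) with h | h | h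
      · exact absurd h hXe1
      · exact h
      · exact absurd h (hblock X hX
          (fun j hj => if hje : j = e then hje ▸ hle.1 heA else hp j hje hj)
          fun j hj => hn j (by rintro rfl; exact hXe1 hj) hj)
    have hke : k ≠ e := by rintro rfl; simp [hXe] at hk
    have finish : ∀ X' ∈ M.circuits, (∀ h, h ≠ k → X' h = 1 → h ∈ A') →
        (∀ h, h ≠ k → X' h = -1 → h ∈ N') → X' e = 1 → X' k = -X k → False := by
      intro X' hX' h1 h2 h3 h4
      obtain ⟨Z, hZ, hZk, hZe, hZb⟩ := M.strong_elimination_of_eq_zero hX' hX (k := k) (f := e)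
        h4 (fun h => by simp [h4] at h; simp [h] at hk) (by simp [h3]) hXe
      have hZk' : ∀ s : SignType, s ≠ 0 → ∀ h, Z h = s → h ≠ k := by
        rintro s hs h hh rfl
        exact hs (hh ▸ hZk)
      have hXe' : ∀ s : SignType, s ≠ 0 → ∀ h, X h = s → h ≠ e := by
        rintro s hs h hh rfl
        exact hs (hh ▸ hXe)
      refine hblock Z hZ (fun h hh => ?_) (fun h hh => ?_) (hZe.trans h3)
      · exact (hZb.eq_one hh).elim (h1 h (hZk' 1 (by decide) h hh))
          fun h' => hp h (hXe' 1 (by decide) h h') h'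
      · exact (hZb.eq_neg_one hh).elim (h2 h (hZk' (-1) (by decide) h hh))
          fun h' => hn h (hXe' (-1) (by decide) h h') h'
    rcases SignType.trichotomy (Y k) with h | h | h
    · obtain ⟨-, h1, h2⟩ := hY2 k h
      obtain ⟨X', hX', hX1, hX2, hX3, hX4⟩ := hA' k h2
      refine finish X' hX' (fun h hh h' => (hX1 h h').resolve_left hh) (fun h _ h' => hX2 h h')
        hX3 ?_
      rw [hX4]; rw [h] at hk; generalize X k = x at hk ⊢; revert x; decide
    · simp [h] at hk
    · obtain ⟨h1, h2⟩ := hY1 k h hke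
      obtain ⟨X', hX', hX1, hX2, hX3, hX4⟩ := hN' k h2 hke
      refine finish X' hX' (fun h _ h' => hX1 h h') (fun h hh h' => (hX2 h h').resolve_left hh)
        hX3 ?_
      rw [hX4]; rw [h] at hk; generalize X k = x at hk ⊢; revert x; decide
  refine ⟨Y, fun X hX => signOrthogonal_of_forall (main X hX) fun k hk => ?_, hYe,
    fun h hh => hYA h (hle.1 hh), fun h hh => hYN h (hle.2 hh)⟩
  obtain ⟨f, hf⟩ := main (-X) (M.neg_mem X hX) k (by simp [hk])
  exact ⟨f, by simpa using hf⟩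

end OrientedMatroid

/-! ### Covector elimination and duality -/

namespace OrientedMatroid

variable {E : Type*} (M : OrientedMatroid E)

/-- Painting with `g` in both sets forces `W g = 0`; other separated elements are left free. A
forbidden circuit would violate orthogonality with `signComp Y Z`, `Y` or `Z`, according to whether
its sign at `g` is zero, that of `Y` or that of `Z`. -/
theorem covector_elimination [Finite E] {Y Z : E → SignType} (hY : Y ∈ M.covectors)
    (hZ : Z ∈ M.covectors) {g e : E} (hg : Y g = -Z g) (hg0 : Y g ≠ 0)
    (he : signComp Y Z e ≠ 0) (hYZe : Y e ≠ -Z e) :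
    ∃ W ∈ M.covectors, W g = 0 ∧ W e = signComp Y Z e ∧
      ∀ h, Y h ≠ -Z h ∨ Y h = 0 → W h = 0 ∨ W h = signComp Y Z h := by
  wlog hpos : signComp Y Z e = 1 generalizing Y Z
  · have hneg : signComp Y Z e = -1 := SignType.eq_neg_of_ne he (by decide) hpos
    obtain ⟨W, hW, hWg, hWe, hWb⟩ := this (M.neg_mem_covectors hY) (M.neg_mem_covectors hZ)
      (by simp [hg]) (by simpa using hg0) (by simpa [signComp_neg] using he)
      (by simpa [neg_eq_iff_eq_neg] using hYZe) (by simp [signComp_neg, hneg])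
    refine ⟨-W, M.neg_mem_covectors hW, by simp [hWg], by simp [hWe, signComp_neg],
      fun h hh => ?_⟩
    have := hWb h (by simpa [neg_eq_iff_eq_neg] using hh)
    simpa [signComp_neg, neg_eq_iff_eq_neg] using this
  have heg : e ≠ g := by
    rintro rfl
    exact hYZe hg
  have hblock : ∀ X ∈ M.circuits,
      (∀ h, X h = 1 → h = g ∨ ((Y h ≠ -Z h ∨ Y h = 0) ∧ 0 ≤ signComp Y Z h)) →
      (∀ h, X h = -1 → h = g ∨ ((Y h ≠ -Z h ∨ Y h = 0) ∧ signComp Y Z h ≤ 0)) → X e ≠ 1 := by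
    intro X hX h1 h2 hXe
    have key : ∀ h, h ≠ g → X h ≠ 0 → (Y h ≠ -Z h ∨ Y h = 0) ∧ X h * signComp Y Z h ≠ -1 := by
      intro h hh hX0
      rcases SignType.trichotomy (X h) with h0 | h0 | h0
      · obtain ⟨ha, hb⟩ := (h2 h h0).resolve_left hh
        refine ⟨ha, fun hc => ?_⟩
        rw [h0] at hc
        generalize signComp Y Z h = s at hb hc
        revert s; decide
      · exact absurd h0 hX0
      · obtain ⟨ha, hb⟩ := (h1 h h0).resolve_left hh
        refine ⟨ha, fun hc => ?_⟩
        rw [h0] at hc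
        generalize signComp Y Z h = s at hb hc
        revert s; decide
    have hne : ∀ {V : E → SignType} {f : E}, X f * V f = -1 → X f ≠ 0 := by
      intro V f hf h0
      simp [h0] at hf
    rcases eq_or_ne (X g) 0 with hXg | hXg
    · obtain ⟨f, hf⟩ := (M.signComp_mem_covectors hY hZ X hX).exists_eq_neg_one (e := e)
        (by rw [hXe, hpos, mul_one])
      exact (key f (by rintro rfl; exact hne hf hXg) (hne hf)).2 hf
    · by_cases hXY : X g = Y g
      · have hg1 : X g * Y g = 1 := by
          rw [hXY]; generalize Y g = s at hg0; revert s; decide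
        obtain ⟨f, hf⟩ := (hY X hX).exists_eq_neg_one hg1
        refine (key f (by rintro rfl; rw [hg1] at hf; revert hf; decide) (hne hf)).2 ?_
        have hYf : Y f ≠ 0 := fun h => by simp [h] at hf
        simpa [signComp, hYf] using hf
      · have hXZ : X g = Z g := by
          rw [SignType.eq_neg_of_ne hXg hg0 hXY, hg, neg_neg]
        have hg1 : X g * Z g = 1 := by
          rw [← hXZ]; generalize X g = s at hXg; revert s; decide
        obtain ⟨f, hf⟩ := (hZ X hX).exists_eq_neg_one hg1
        obtain ⟨h3, h4⟩ := key f (by rintro rfl; rw [hg1] at hf; revert hf; decide) (hne hf)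
        have hZf : Z f ≠ 0 := fun h => by simp [h] at hf
        refine h4 ?_
        by_cases hYf : Y f = 0
        · simpa [signComp, hYf] using hf
        · have : Y f = Z f := by
            by_contra hc
            exact (h3.resolve_right hYf) (SignType.eq_neg_of_ne hYf hZf hc)
          simpa [signComp, hYf, this] using hf
  obtain ⟨W, hW, hWe, hWA, hWN⟩ := M.exists_covector_of_forall_circuit
    {h | h = g ∨ ((Y h ≠ -Z h ∨ Y h = 0) ∧ 0 ≤ signComp Y Z h)}
    {h | h = g ∨ ((Y h ≠ -Z h ∨ Y h = 0) ∧ signComp Y Z h ≤ 0)} (e := e)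
    (Or.inr ⟨Or.inl hYZe, by rw [hpos]; decide⟩)
    (by
      rintro (h | ⟨-, h⟩)
      · exact heg h
      · rw [hpos] at h; revert h; decide) hblock
  refine ⟨W, hW, le_antisymm (hWN g (Or.inl rfl)) (hWA g (Or.inl rfl)), hWe.trans hpos.symm,
    fun h hh => ?_⟩
  have h1 : 0 ≤ signComp Y Z h → 0 ≤ W h := fun h' => hWA h (Or.inr ⟨hh, h'⟩)
  have h2 : signComp Y Z h ≤ 0 → W h ≤ 0 := fun h' => hWN h (Or.inr ⟨hh, h'⟩)
  generalize signComp Y Z h = s at h1 h2 ⊢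
  generalize W h = w at h1 h2 ⊢
  clear * - h1 h2
  revert s w
  decide

/-- A covector of strictly smaller support agreeing with `Y` at `e` can be replaced by one which is
moreover conformal to `Y`. -/
theorem exists_conformal_covector [Finite E] {Y Z : E → SignType} (hY : Y ∈ M.covectors)
    (hZ : Z ∈ M.covectors) {e f : E} (hYe : Y e ≠ 0) (hZe : Z e = Y e)
    (hsub : ∀ h, Y h = 0 → Z h = 0) (hYf : Y f ≠ 0) (hZf : Z f = 0) :
    ∃ W ∈ M.covectors, W e = Y e ∧ (∀ h, W h = 0 ∨ W h = Y h) ∧ ∃ f, Y f ≠ 0 ∧ W f = 0 := by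
  have step : ∀ V : E → SignType, (V ∈ M.covectors ∧ V e = Y e ∧ (∀ h, Y h = 0 → V h = 0) ∧
      ∃ f, Y f ≠ 0 ∧ V f = 0) → ∀ g ∈ {h | Y h ≠ 0 ∧ Y h = -V h},
      ∃ W : E → SignType, (W ∈ M.covectors ∧ W e = Y e ∧ (∀ h, Y h = 0 → W h = 0) ∧
        ∃ f, Y f ≠ 0 ∧ W f = 0) ∧
        {h | Y h ≠ 0 ∧ Y h = -W h} ⊂ {h | Y h ≠ 0 ∧ Y h = -V h} := by
    rintro V ⟨hV, hVe, hVs, -⟩ g ⟨hg0, hg⟩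
    have hc : ∀ h, Y h ≠ 0 → signComp Y V h = Y h := fun h hh => by simp [signComp, hh]
    obtain ⟨W, hW, hWg, hWe, hWb⟩ := M.covector_elimination hY hV hg hg0 (e := e)
      (by rwa [hc e hYe]) (by rw [hVe]; exact (SignType.neg_ne_self hYe).symm)
    refine ⟨W, ⟨hW, hWe.trans (hc e hYe), fun h hh => ?_, g, hg0, hWg⟩, ?_⟩
    · simpa [signComp, hh, hVs h hh] using hWb h (Or.inr hh)
    · refine (Set.ssubset_iff_of_subset ?_).2 ⟨g, ⟨hg0, hg⟩, fun h => ?_⟩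
      · rintro h ⟨hh, hh'⟩
        refine ⟨hh, ?_⟩
        by_contra hcon
        rcases hWb h (Or.inl hcon) with h1 | h1
        · exact hh (by rw [hh', h1, neg_zero])
        · rw [hc h hh] at h1
          exact SignType.neg_ne_self hh (by rw [← h1, ← hh', h1])
      · exact hg0 (by rw [h.2, hWg, neg_zero])
  obtain ⟨W, ⟨hW, hWe, hWs, hWf⟩, hWb⟩ := exists_eq_empty_of_ssubset_step _ step Z
    ⟨hZ, hZe, hsub, f, hYf, hZf⟩
  refine ⟨W, hW, hWe, fun h => ?_, hWf⟩
  by_contra hc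
  rw [not_or] at hc
  have hYh : Y h ≠ 0 := fun h0 => hc.1 (hWs h h0)
  exact Set.eq_empty_iff_forall_notMem.1 hWb h
    ⟨hYh, SignType.eq_neg_of_ne hYh hc.1 (Ne.symm hc.2)⟩

/-- A conformal covector `D` of least support through `e` works. A covector of smaller support that
is nonzero at `e` could, up to sign, be made conformal to `D`. One vanishing at `e` yields such a
covector by elimination with `D`. -/
theorem exists_cocircuit_of_covector [Finite E] {Y : E → SignType} (hY : Y ∈ M.covectors) {e : E}
    (he : Y e ≠ 0) : ∃ D ∈ M.cocircuits, D e = Y e ∧ ∀ h, D h = 0 ∨ D h = Y h := by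
  obtain ⟨D, ⟨hD, hDe, hDb⟩, hmin⟩ := Set.exists_min_image
    {D | D ∈ M.covectors ∧ D e = Y e ∧ ∀ h, D h = 0 ∨ D h = Y h}
    (fun D => (Function.support D).ncard) (Set.toFinite _) ⟨Y, hY, rfl, fun h => Or.inr rfl⟩
  have hDe0 : D e ≠ 0 := hDe ▸ he
  have smaller : ∀ W ∈ M.covectors, W e = D e → (∀ h, W h = 0 ∨ W h = D h) →
      (∃ f, D f ≠ 0 ∧ W f = 0) → False := by
    rintro W hW hWe hWb ⟨f, hf, hWf⟩
    refine absurd (hmin W ⟨hW, hWe.trans hDe, fun h => ?_⟩) (not_le.2 ?_)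
    · rcases hWb h with h0 | h0
      · exact Or.inl h0
      · rw [h0]; exact hDb h
    · refine Set.ncard_lt_ncard ((Set.ssubset_iff_of_subset fun h hh hh' => ?_).2
        ⟨f, hf, fun h => h hWf⟩) (Set.toFinite _)
      rcases hWb h with h0 | h0
      · exact hh h0
      · exact hh (h0.trans hh')
  have smaller' : ∀ Z ∈ M.covectors, Z e ≠ 0 → (∀ h, D h = 0 → Z h = 0) →
      (∃ f, D f ≠ 0 ∧ Z f = 0) → False := by
    rintro Z hZ hZe hsub ⟨f, hf, hZf⟩
    by_cases hZD : Z e = D e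
    · obtain ⟨W, hW, hWe, hWb, hWf⟩ := M.exists_conformal_covector hD hZ hDe0 hZD hsub hf hZf
      exact smaller W hW hWe hWb hWf
    · obtain ⟨W, hW, hWe, hWb, hWf⟩ := M.exists_conformal_covector hD (M.neg_mem_covectors hZ)
        hDe0 (by simp [SignType.eq_neg_of_ne hZe hDe0 hZD]) (fun h hh => by simp [hsub h hh]) hf
        (by simp [hZf])
      exact smaller W hW hWe hWb hWf
  refine ⟨D, ⟨fun h => hDe0 (by simp [h]), hD, fun Z hZ0 hZ hsub => ?_⟩, hDe, hDb⟩
  refine hsub.antisymm fun f hf => ?_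
  by_contra hZf
  simp only [Function.mem_support, not_not] at hf hZf
  have hsub' : ∀ h, D h = 0 → Z h = 0 := by
    intro h hh
    by_contra hc
    exact hsub hc hh
  by_cases hZe : Z e = 0
  swap
  · exact smaller' Z hZ hZe hsub' ⟨f, hf, hZf⟩
  have opp : ∀ V ∈ M.covectors, (∀ h, D h = 0 → V h = 0) → V e = 0 →
      ∀ g, D g ≠ 0 → D g = -V g → False := by
    intro V hV hVs hVe g hg0 hg
    obtain ⟨W, hW, hWg, hWe, hWb⟩ := M.covector_elimination hD hV hg hg0 (e := e)
      (by simp [signComp, hDe0]) (by simp [hVe, hDe0])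
    refine smaller' W hW (by simp [hWe, signComp, hDe0]) (fun h hh => ?_) ⟨g, hg0, hWg⟩
    simpa [signComp, hh, hVs h hh] using hWb h (Or.inr hh)
  obtain ⟨g, hg⟩ := Function.ne_iff.1 hZ0
  simp only [Pi.zero_apply] at hg
  have hDg : D g ≠ 0 := fun h => hg (hsub' g h)
  by_cases hZD : D g = Z g
  · exact opp (-Z) (M.neg_mem_covectors hZ) (fun h hh => by simp [hsub' h hh]) (by simp [hZe]) g hDg
      (by simp [hZD])
  · exact opp Z hZ hsub' hZe g hDg (SignType.eq_neg_of_ne hDg hg hZD)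

theorem neg_mem_cocircuits {Y : E → SignType} (hY : Y ∈ M.cocircuits) : -Y ∈ M.cocircuits := by
  refine ⟨fun h => hY.1 (by funext e; simpa using congrFun h e), M.neg_mem_covectors hY.2.1, ?_⟩
  have : Function.support (-Y) = Function.support Y := by
    ext h; simp
  rw [this]
  exact hY.2.2

/-- The dual oriented matroid. -/
def dual [Finite E] : OrientedMatroid E where
  circuits := M.cocircuits
  zero_notMem := fun h => h.1 rfl
  neg_mem := fun _ => M.neg_mem_cocircuits
  incomparable := by
    intro Y hY Z hZ hsub
    by_contra hc
    rw [not_or] at hc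
    have hsupp := hZ.2.2 Y hY.1 hY.2.1 hsub
    have hiff : ∀ h, Y h = 0 ↔ Z h = 0 := fun h => by
      simpa [not_iff_not] using Set.ext_iff.1 hsupp h
    obtain ⟨g, hg⟩ := Function.ne_iff.1 hc.1
    obtain ⟨f, hf⟩ := Function.ne_iff.1 hc.2
    have hYg : Y g ≠ 0 := fun h => hg (by rw [h, (hiff g).1 h])
    have hYf : Y f ≠ 0 := fun h => hf (by simp [h, (hiff f).1 h])
    -- The supports coincide, so `Y` and `Z` are opposite at `g` and equal at `f`; eliminating `g`
    -- while keeping `f` contradicts minimality of the support.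
    obtain ⟨W, hW, hWg, hWf, hWb⟩ := M.covector_elimination hY.2.1 hZ.2.1 (e := f)
      (SignType.eq_neg_of_ne hYg (fun h => hYg ((hiff g).2 h)) hg) hYg
      (by simp [signComp, hYf]) hf
    have hWY : Function.support W ⊆ Function.support Y := by
      intro h hh hh'
      have := hWb h (Or.inr hh')
      simp only [signComp, hh', (hiff h).1 hh', if_true, or_self] at this
      exact hh this
    have := hY.2.2 W (fun h => hYf (by simpa [h, signComp, hYf] using hWf.symm)) hW hWY
    exact (Set.ext_iff.1 this g).2 hYg hWg
  elimination := by
    intro X hX Y hY hXY e hXe hYe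
    obtain ⟨f, hf⟩ := Function.ne_iff.1 hXY
    have hcf : signComp X Y f ≠ 0 := by
      intro h
      simp only [signComp] at h
      split_ifs at h with h0
      · exact hf (by simp [h0, h])
      · exact h0 h
    obtain ⟨W, hW, hWe, hWf, hWb⟩ := M.covector_elimination hX.2.1 hY.2.1 (g := e) (e := f)
      (by rw [hXe, hYe, neg_neg]) (by rw [hXe]; decide) hcf hf
    -- Here `f` serves only as a nonzero entry of `W`.
    obtain ⟨D, hD, -, hDb⟩ := M.exists_cocircuit_of_covector hW (e := f) (hWf ▸ hcf)
    have key : ∀ h s, s ≠ 0 → D h = s → X h = s ∨ Y h = s := by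
      intro h s hs hDs
      have hWs : W h = s := by
        rcases hDb h with h0 | h0
        · exact absurd (hDs.symm.trans h0) hs
        · exact h0.symm.trans hDs
      have h1 := hWb h
      simp only [signComp] at h1
      rw [hWs] at h1
      generalize X h = x at h1 ⊢
      generalize Y h = y at h1 ⊢
      clear * - h1 hs
      revert s x y
      decide
    refine ⟨D, hD, ?_, fun h => key h 1 (by decide), fun h => key h (-1) (by decide)⟩
    simpa [hWe] using hDb e

end OrientedMatroid

/-! ### Reorientation and its compatibility with duality -/

theorem flipSigns_comp {E : Type*} (A B : Set E) (X : E → SignType) :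
    flipSigns A (flipSigns B X) = flipSigns (symmDiff A B) X := by
  funext e
  by_cases hA : e ∈ A <;> by_cases hB : e ∈ B <;>
    simp [flipSigns, hA, hB, Set.mem_symmDiff]

theorem flipSigns_mul_flipSigns {E : Type*} (A : Set E) (X Y : E → SignType) (e : E) :
    flipSigns A X e * flipSigns A Y e = X e * Y e := by
  by_cases hA : e ∈ A <;> simp [flipSigns, hA]

theorem signOrthogonal_flipSigns {E : Type*} (A : Set E) (X Y : E → SignType) :
    SignOrthogonal (flipSigns A X) (flipSigns A Y) ↔ SignOrthogonal X Y := by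
  simp only [SignOrthogonal, flipSigns_mul_flipSigns]

theorem SignType.eq_one_of_nonneg {x : SignType} (h : 0 ≤ x) (h0 : x ≠ 0) : x = 1 := by
  revert x; decide

namespace OrientedMatroid

variable {E : Type*} (M : OrientedMatroid E)

theorem eq_of_circuits_eq {M N : OrientedMatroid E} (h : M.circuits = N.circuits) : M = N := by
  cases M; cases N; congr

theorem reorient_reorient (A B : Set E) :
    (M.reorient A).reorient B = M.reorient (symmDiff A B) := by
  apply eq_of_circuits_eq
  ext X
  change flipSigns A (flipSigns B X) ∈ M.circuits ↔ flipSigns (symmDiff A B) X ∈ M.circuits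
  rw [flipSigns_comp]

theorem reorient_empty : M.reorient ∅ = M := by
  apply eq_of_circuits_eq
  ext X
  change flipSigns ∅ X ∈ M.circuits ↔ X ∈ M.circuits
  have : flipSigns ∅ X = X := funext fun e => flipSigns_of_notMem (Set.notMem_empty e) X
  rw [this]

theorem reorient_reorient_self (A : Set E) : (M.reorient A).reorient A = M := by
  rw [reorient_reorient, symmDiff_self]
  exact M.reorient_empty

theorem mem_covectors_reorient {A : Set E} {Y : E → SignType} :
    Y ∈ (M.reorient A).covectors ↔ flipSigns A Y ∈ M.covectors := by
  constructor
  · intro h X hX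
    have := h (flipSigns A X) (by
      change flipSigns A (flipSigns A X) ∈ M.circuits
      rwa [flipSigns_flipSigns])
    rwa [← signOrthogonal_flipSigns A, flipSigns_flipSigns] at this
  · intro h X hX
    exact (signOrthogonal_flipSigns A X Y).1 (h _ hX)

theorem flipSigns_ne_zero {A : Set E} {Y : E → SignType} : flipSigns A Y ≠ 0 ↔ Y ≠ 0 := by
  rw [← Function.support_nonempty_iff, ← Function.support_nonempty_iff, support_flipSigns]

theorem mem_cocircuits_reorient {A : Set E} {Y : E → SignType} :
    Y ∈ (M.reorient A).cocircuits ↔ flipSigns A Y ∈ M.cocircuits := by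
  have key : ∀ (N : OrientedMatroid E) (Y : E → SignType), flipSigns A Y ∈ N.cocircuits →
      Y ∈ (N.reorient A).cocircuits := by
    intro N Y h
    refine ⟨flipSigns_ne_zero.1 h.1, N.mem_covectors_reorient.2 h.2.1, fun Z hZ0 hZ hsub => ?_⟩
    have := h.2.2 (flipSigns A Z) (flipSigns_ne_zero.2 hZ0) (N.mem_covectors_reorient.1 hZ)
    rw [support_flipSigns, support_flipSigns] at this
    exact this hsub
  refine ⟨fun h => ?_, key M Y⟩
  have := key (M.reorient A) (flipSigns A Y) (by rwa [flipSigns_flipSigns])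
  rwa [reorient_reorient_self] at this

/-- Allows the results on positive circuits to be reused for positive cocircuits. -/
theorem dual_reorient [Finite E] (A : Set E) : (M.reorient A).dual = M.dual.reorient A :=
  eq_of_circuits_eq (Set.ext fun _ => M.mem_cocircuits_reorient)

/-! ### Positive circuits and cocircuits -/

theorem IsPositiveCircuit.notMem_of_isPositiveCocircuit {M : OrientedMatroid E} {C D : Set E}
    (hC : M.IsPositiveCircuit C) (hD : M.IsPositiveCocircuit D) {e : E} (he : e ∈ C) : e ∉ D := by
  rintro he'
  obtain ⟨X, hX, hXp, rfl⟩ := hC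
  obtain ⟨Y, hY, hYp, rfl⟩ := hD
  obtain ⟨f, hf⟩ := (hY.2.1 X hX).exists_eq_neg_one (e := e) (by
    rw [SignType.eq_one_of_nonneg (hXp e) he, SignType.eq_one_of_nonneg (hYp e) he', mul_one])
  have h1 := hXp f
  have h2 := hYp f
  generalize X f = x at *
  generalize Y f = y at *
  revert hf h1 h2
  clear * -
  revert x y
  decide

/-- Every element is in a positive circuit or in a positive cocircuit. -/
theorem exists_isPositiveCircuit_or_isPositiveCocircuit [Finite E] (e : E) :
    (∃ C, M.IsPositiveCircuit C ∧ e ∈ C) ∨ ∃ D, M.IsPositiveCocircuit D ∧ e ∈ D := by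
  by_contra hc
  rw [not_or] at hc
  have hblock : ∀ X ∈ M.circuits, (∀ h, X h = 1 → h ∈ (Set.univ : Set E)) →
      (∀ h, X h = -1 → h ∈ (∅ : Set E)) → X e ≠ 1 := by
    intro X hX _ hn hXe
    refine hc.1 ⟨_, ⟨X, hX, fun h => ?_, rfl⟩, by simp [hXe]⟩
    rcases SignType.trichotomy (X h) with h0 | h0 | h0
    · exact absurd (hn h h0) (Set.notMem_empty h)
    · exact h0.ge
    · rw [h0]; decide
  -- With every positive sign allowed and no negative one, painting gives a nonnegative covector,
  -- and a conformal cocircuit through `e` is then positive.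
  obtain ⟨Y, hY, hYe, hYp, -⟩ := M.exists_covector_of_forall_circuit Set.univ ∅ (e := e)
    trivial (Set.notMem_empty e) hblock
  obtain ⟨D, hD, hDe, hDb⟩ := M.exists_cocircuit_of_covector hY (e := e) (by simp [hYe])
  refine hc.2 ⟨_, ⟨D, hD, fun h => ?_, rfl⟩, by simp [hDe, hYe]⟩
  rcases hDb h with h0 | h0
  · exact h0.ge
  · rw [h0]; exact hYp h trivial

/-- A circuit which is nonnegative outside a union `A` of positive circuits can be made positive,
keeping any element outside `A`, at the expense of adding elements of `A`. -/
theorem exists_isPositiveCircuit_of_nonneg_off [Finite E] {A : Set E}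
    (hA : ∀ e ∈ A, ∃ C, M.IsPositiveCircuit C ∧ e ∈ C ∧ C ⊆ A) {X : E → SignType}
    (hX : X ∈ M.circuits) (hXp : ∀ h ∉ A, 0 ≤ X h) {e : E} (he : X e ≠ 0) :
    ∃ C, M.IsPositiveCircuit C ∧ e ∈ C ∧ C ⊆ A ∪ Function.support X := by
  by_cases heA : e ∈ A
  · obtain ⟨C, hC, heC, hCA⟩ := hA e heA
    exact ⟨C, hC, heC, hCA.trans Set.subset_union_left⟩
  have hXe := SignType.eq_one_of_nonneg (hXp e heA) he
  -- A negative element of `V` lies in `A`, hence in a positive circuit inside `A`. That circuit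
  -- avoids `e`, so eliminating against it keeps `e` and creates no new negative element.
  have step : ∀ V : E → SignType, (V ∈ M.circuits ∧ V e = 1 ∧ (∀ h ∉ A, 0 ≤ V h) ∧
      Function.support V ⊆ A ∪ Function.support X) → ∀ g ∈ {h | V h = -1},
      ∃ W : E → SignType, (W ∈ M.circuits ∧ W e = 1 ∧ (∀ h ∉ A, 0 ≤ W h) ∧
        Function.support W ⊆ A ∪ Function.support X) ∧ {h | W h = -1} ⊂ {h | V h = -1} := by
    rintro V ⟨hV, hVe, hVp, hVs⟩ g hg
    have hgA : g ∈ A := by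
      by_contra hc
      have := hVp g hc
      rw [Set.mem_ofPred_eq] at hg
      rw [hg] at this
      revert this; decide
    obtain ⟨C, ⟨D, hD, hDp, rfl⟩, hgC, hCA⟩ := hA g hgA
    have hDg := SignType.eq_one_of_nonneg (hDp g) hgC
    have hD0 : ∀ h ∉ A, D h = 0 := fun h hh => by
      by_contra hc
      exact hh (hCA hc)
    obtain ⟨W, hW, hWg, hWe, hWb⟩ := M.strong_elimination_of_eq_zero hV hD (k := g) (f := e)
      (hg.trans (by rw [hDg])) (by rw [Set.mem_ofPred_eq] at hg; simp [hg]) (by simp [hVe])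
      (hD0 e heA)
    refine ⟨W, ⟨hW, hWe.trans hVe, fun h hh => ?_, fun h hh => ?_⟩, ?_⟩
    · rcases hWb h with h0 | h0 | h0
      · exact h0.ge
      · rw [h0]; exact hVp h hh
      · rw [h0]; exact hDp h
    · rcases hWb h with h0 | h0 | h0
      · exact absurd h0 hh
      · exact hVs (fun h' => hh (h0.trans h'))
      · exact Or.inl (hCA fun h' => hh (h0.trans h'))
    · refine (Set.ssubset_iff_of_subset fun h hh => ?_).2 ⟨g, hg, fun h => ?_⟩
      · refine (hWb.eq_neg_one hh).resolve_right fun h' => ?_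
        have := hDp h
        rw [h'] at this
        revert this; decide
      · rw [Set.mem_ofPred_eq, hWg] at h
        revert h; decide
  obtain ⟨W, ⟨hW, hWe, -, hWs⟩, hWb⟩ := exists_eq_empty_of_ssubset_step _ step X
    ⟨hX, hXe, hXp, Set.subset_union_right⟩
  refine ⟨_, ⟨W, hW, fun h => ?_, rfl⟩, by simp [hWe], hWs⟩
  rcases SignType.trichotomy (W h) with h0 | h0 | h0
  · exact absurd h0 (Set.eq_empty_iff_forall_notMem.1 hWb h)
  · exact h0.ge
  · rw [h0]; decide

theorem IsPositiveCircuit.reorient_of_subset {M : OrientedMatroid E} {A C : Set E}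
    (hC : M.IsPositiveCircuit C) (hCA : C ⊆ A) : (M.reorient A).IsPositiveCircuit C := by
  obtain ⟨X, hX, hXp, rfl⟩ := hC
  refine ⟨X, ?_, hXp, rfl⟩
  change flipSigns A X ∈ M.circuits
  have : flipSigns A X = -X := by
    funext e
    by_cases he : e ∈ A
    · exact flipSigns_of_mem he X
    · have h0 : X e = 0 := by
        by_contra hc
        exact he (hCA hc)
      simp [flipSigns_of_notMem he, h0]
  rw [this]
  exact M.neg_mem X hX

theorem IsPositiveCircuit.reorient_of_disjoint {M : OrientedMatroid E} {A C : Set E}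
    (hC : M.IsPositiveCircuit C) (hCA : ∀ e ∈ C, e ∉ A) :
    (M.reorient A).IsPositiveCircuit C := by
  obtain ⟨X, hX, hXp, rfl⟩ := hC
  refine ⟨X, ?_, hXp, rfl⟩
  change flipSigns A X ∈ M.circuits
  have : flipSigns A X = X := by
    funext e
    by_cases he : e ∈ A
    · have h0 : X e = 0 := by
        by_contra hc
        exact hCA e hc he
      simp [flipSigns_of_mem he, h0]
    · exact flipSigns_of_notMem he X
  rwa [this]

/-! ### Invariance of the bounded unions -/

section Order

variable [LinearOrder E]

theorem circuitUnionGE_reorient_of_disjoint {A : Set E}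
    (h1 : ∀ C, M.IsPositiveCircuit C → ∀ e ∈ C, e ∉ A)
    (h2 : ∀ C, (M.reorient A).IsPositiveCircuit C → ∀ e ∈ C, e ∉ A) (b : E) :
    (M.reorient A).circuitUnionGE b = M.circuitUnionGE b := by
  have : ∀ C, (M.reorient A).IsPositiveCircuit C ↔ M.IsPositiveCircuit C := fun C =>
    ⟨fun hC => by simpa [reorient_reorient_self] using hC.reorient_of_disjoint (h2 C hC),
      fun hC => hC.reorient_of_disjoint (h1 C hC)⟩
  simp only [circuitUnionGE, this]

theorem le_of_mem_circuitUnionGE {M : OrientedMatroid E} {a e : E}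
    (h : e ∈ M.circuitUnionGE a) : a ≤ e := by
  obtain ⟨C, ⟨-, hC⟩, he⟩ := h
  exact hC e he

theorem exists_isPositiveCircuit_of_mem_circuitUnionGE {a e : E} (h : e ∈ M.circuitUnionGE a) :
    ∃ C, M.IsPositiveCircuit C ∧ e ∈ C ∧ C ⊆ M.circuitUnionGE a := by
  obtain ⟨C, hC, he⟩ := h
  exact ⟨C, hC.1, he, fun x hx => ⟨C, hC, hx⟩⟩

theorem circuitUnionGE_anti {a b : E} (h : a ≤ b) : M.circuitUnionGE b ⊆ M.circuitUnionGE a :=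
  fun _ ⟨C, hC, he⟩ => ⟨C, ⟨hC.1, fun x hx => h.trans (hC.2 x hx)⟩, he⟩

theorem IsPositiveCircuit.exists_of_reorient [Finite E] {M : OrientedMatroid E} {a : E}
    {C : Set E} (hC : (M.reorient (M.circuitUnionGE a)).IsPositiveCircuit C) {e : E}
    (he : e ∈ C) : ∃ C', M.IsPositiveCircuit C' ∧ e ∈ C' ∧ C' ⊆ M.circuitUnionGE a ∪ C := by
  obtain ⟨X, hX, hXp, rfl⟩ := hC
  obtain ⟨C', hC', heC', hsub⟩ := M.exists_isPositiveCircuit_of_nonneg_off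
    (fun e => M.exists_isPositiveCircuit_of_mem_circuitUnionGE (a := a) (e := e)) hX
    (fun h hh => by rw [flipSigns_of_notMem hh]; exact hXp h) (e := e)
    (by
      have : e ∈ Function.support (flipSigns (M.circuitUnionGE a) X) := by
        rwa [support_flipSigns]
      exact this)
  rw [support_flipSigns] at hsub
  exact ⟨C', hC', heC', hsub⟩

/-- For b ≤ a, the repaired circuit lies in U(a) ∪ C, hence above b. For a ≤ b, repair through each
element shows C ⊆ U(a), so C is merely negated by the reorientation. -/
theorem circuitUnionGE_reorient_le [Finite E] (a b : E) :
    (M.reorient (M.circuitUnionGE a)).circuitUnionGE b ⊆ M.circuitUnionGE b := by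
  rintro e ⟨C, ⟨hC, hCb⟩, he⟩
  rcases le_total a b with hab | hba
  · have hCA : C ⊆ M.circuitUnionGE a := by
      intro x hx
      obtain ⟨C', hC', hxC', hsub⟩ := hC.exists_of_reorient hx
      exact ⟨C', ⟨hC', fun y hy => (hsub hy).elim le_of_mem_circuitUnionGE
        fun h => hab.trans (hCb y h)⟩, hxC'⟩
    refine ⟨C, ⟨?_, hCb⟩, he⟩
    simpa [reorient_reorient_self] using hC.reorient_of_subset hCA
  · obtain ⟨C', hC', heC', hsub⟩ := hC.exists_of_reorient he
    exact ⟨C', ⟨hC', fun y hy => (hsub hy).elim (fun h => hba.trans (le_of_mem_circuitUnionGE h))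
      (hCb y)⟩, heC'⟩

/-- Since U(a) itself is preserved, reorienting it again returns to `M`, and the one-sided inclusion
applies in both directions. -/
theorem circuitUnionGE_reorient [Finite E] (a b : E) :
    (M.reorient (M.circuitUnionGE a)).circuitUnionGE b = M.circuitUnionGE b := by
  have hself : (M.reorient (M.circuitUnionGE a)).circuitUnionGE a = M.circuitUnionGE a := by
    refine (M.circuitUnionGE_reorient_le a a).antisymm ?_
    rintro e ⟨C, ⟨hC, hCa⟩, he⟩
    exact ⟨C, ⟨hC.reorient_of_subset fun x hx => ⟨C, ⟨hC, hCa⟩, hx⟩, hCa⟩, he⟩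
  refine (M.circuitUnionGE_reorient_le a b).antisymm ?_
  have := (M.reorient (M.circuitUnionGE a)).circuitUnionGE_reorient_le a b
  rwa [hself, reorient_reorient_self] at this

theorem notMem_circuitUnionGE_of_dual [Finite E] {C : Set E} (hC : M.IsPositiveCircuit C)
    {e a : E} (he : e ∈ C) : e ∉ M.dual.circuitUnionGE a := fun ⟨_, hD, heD⟩ =>
  hC.notMem_of_isPositiveCocircuit hD.1 he heD

/-- Both oriented matroids have the same unions of positive circuits, and of positive cocircuits,
with bounded below minimum. -/
def SameUnions [Finite E] (M N : OrientedMatroid E) : Prop :=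
  M.circuitUnionGE = N.circuitUnionGE ∧ M.dual.circuitUnionGE = N.dual.circuitUnionGE

theorem SameUnions.trans [Finite E] {L M N : OrientedMatroid E} (h : SameUnions L M)
    (h' : SameUnions M N) : SameUnions L N := ⟨h.1.trans h'.1, h.2.trans h'.2⟩

/-- For the dual half, positive cocircuits before and after both avoid U(a); the latter uses that
U(a) is preserved. -/
theorem sameUnions_reorient [Finite E] (a : E) :
    SameUnions (M.reorient (M.circuitUnionGE a)) M := by
  refine ⟨funext (M.circuitUnionGE_reorient a), funext fun b => ?_⟩
  rw [dual_reorient]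
  have key : ∀ N : OrientedMatroid E, ∀ C, N.dual.IsPositiveCircuit C → ∀ e ∈ C,
      e ∉ N.circuitUnionGE a := fun N C hC e he ⟨C', hC', he'⟩ =>
    hC'.1.notMem_of_isPositiveCocircuit hC he' he
  apply circuitUnionGE_reorient_of_disjoint _ (key M)
  have := key (M.reorient (M.circuitUnionGE a))
  rwa [M.circuitUnionGE_reorient a a, dual_reorient] at this

theorem sameUnions_reorient_dual [Finite E] (a : E) :
    SameUnions (M.reorient (M.dual.circuitUnionGE a)) M := by
  have hd : (M.reorient (M.dual.circuitUnionGE a)).dual.circuitUnionGE = M.dual.circuitUnionGE := by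
    rw [dual_reorient]
    exact funext (M.dual.circuitUnionGE_reorient a)
  refine ⟨funext fun b => M.circuitUnionGE_reorient_of_disjoint
    (fun C hC e he => M.notMem_circuitUnionGE_of_dual hC he) (fun C hC e he => ?_) b, hd⟩
  have := (M.reorient (M.dual.circuitUnionGE a)).notMem_circuitUnionGE_of_dual hC he (a := a)
  rwa [hd] at this

end Order

end OrientedMatroid

/-! ### From filtration lists to set partitions -/

/-- By nestedness, the entry following `f a` is the union of all later `f b`; the final `∅` is the
empty union. -/
theorem exists_consecutive_diff_iff {E : Type*} [LinearOrder E] {f : E → Set E} (hf : Antitone f)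
    {l : List E} (hl : l.Pairwise (· < ·)) (P : Set E) :
    (∃ (k : ℕ) (F G : Set E), (l.map f ++ [∅])[k]? = some F ∧
      (l.map f ++ [∅])[k + 1]? = some G ∧ P = F \ G) ↔
    ∃ a ∈ l, P = {e | e ∈ f a ∧ ∀ b ∈ l, a < b → e ∉ f b} := by
  induction l with
  | nil => simp
  | cons a l ih =>
    rw [List.pairwise_cons] at hl
    have hhead : ∃ G, (l.map f ++ [∅])[0]? = some G ∧ ∀ e, e ∈ G ↔ ∃ b ∈ l, e ∈ f b := by
      cases l with
      | nil => exact ⟨∅, by simp⟩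
      | cons b l =>
        refine ⟨f b, by simp, fun e => ⟨fun he => ⟨b, by simp, he⟩, ?_⟩⟩
        rintro ⟨c, hc, he⟩
        rcases List.mem_cons.1 hc with rfl | hc
        · exact he
        · exact hf ((List.pairwise_cons.1 hl.2).1 c hc).le he
    obtain ⟨G₀, hG₀, hmem⟩ := hhead
    have h0 : f a \ G₀ = {e | e ∈ f a ∧ ∀ b ∈ a :: l, a < b → e ∉ f b} := by
      ext e
      simp only [Set.mem_sdiff, hmem, Set.mem_ofPred_eq, List.mem_cons, forall_eq_or_imp, lt_irrefl,
        false_imp_iff, true_and, not_exists, not_and]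
      exact and_congr_right fun _ => forall₂_congr fun b hb => by simp [hl.1 b hb]
    have h1 : ∀ a' ∈ l, {e | e ∈ f a' ∧ ∀ b ∈ a :: l, a' < b → e ∉ f b} =
        {e | e ∈ f a' ∧ ∀ b ∈ l, a' < b → e ∉ f b} := by
      intro a' ha'
      simp [(hl.1 a' ha').not_gt]
    constructor
    · rintro ⟨k, F, G, hF, hG, rfl⟩
      cases k with
      | zero =>
        simp only [List.map_cons, List.cons_append, List.getElem?_cons_zero, zero_add,
          List.getElem?_cons_succ, hG₀, Option.some.injEq] at hF hG
        exact ⟨a, List.mem_cons_self, by rw [← h0, hF, hG]⟩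
      | succ k =>
        simp only [List.map_cons, List.cons_append, List.getElem?_cons_succ] at hF hG
        obtain ⟨a', ha', h⟩ := (ih hl.2).1 ⟨k, F, G, hF, hG, rfl⟩
        exact ⟨a', List.mem_cons_of_mem _ ha', by rw [h1 a' ha', h]⟩
    · rintro ⟨a', ha', rfl⟩
      rcases List.mem_cons.1 ha' with rfl | ha'
      · exact ⟨0, f a', G₀, by simp, by simpa using hG₀, h0.symm⟩
      · obtain ⟨k, F, G, hF, hG, h⟩ := (ih hl.2).2 ⟨a', ha', h1 a' ha'⟩
        exact ⟨k + 1, F, G, by simpa using hF, by simpa using hG, h⟩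

theorem pairwise_sortedElements {E : Type*} [Fintype E] [LinearOrder E] (S : Set E) :
    (sortedElements S).Pairwise (· < ·) := (Finset.sortedLT_sort _).pairwise

theorem mem_sortedElements {E : Type*} [Fintype E] [LinearOrder E] {S : Set E} {a : E} :
    a ∈ sortedElements S ↔ a ∈ S := by
  simp [sortedElements]

namespace Setoid.IsPartition

variable {α : Type*} {c : Set (Set α)}

theorem mem_of_mem_sUnion (hc : IsPartition c) {S : Set (Set α)} (hS : S ⊆ c) {P : Set α}
    (hP : P ∈ c) {e : α} (heP : e ∈ P) (he : e ∈ ⋃₀ S) : P ∈ S := by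
  obtain ⟨Q, hQ, heQ⟩ := he
  rwa [(hc.2 e).unique ⟨hP, heP⟩ ⟨hS hQ, heQ⟩]

theorem sUnion_symmDiff (hc : IsPartition c) {S T : Set (Set α)} (hS : S ⊆ c) (hT : T ⊆ c) :
    ⋃₀ symmDiff S T = symmDiff (⋃₀ S) (⋃₀ T) := by
  ext e
  obtain ⟨P, ⟨hP, heP⟩, -⟩ := hc.2 e
  have key : ∀ S ⊆ c, (e ∈ ⋃₀ S ↔ P ∈ S) := fun S hS =>
    ⟨hc.mem_of_mem_sUnion hS hP heP, fun h => ⟨P, h, heP⟩⟩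
  rw [key _ (fun Q hQ => hQ.elim (fun h => hS h.1) fun h => hT h.1), Set.mem_symmDiff,
    Set.mem_symmDiff, key S hS, key T hT]

theorem injOn_sUnion (hc : IsPartition c) : Set.InjOn Set.sUnion (𝒫 c) := by
  have key : ∀ S ∈ 𝒫 c, ∀ T ∈ 𝒫 c, ⋃₀ S = ⋃₀ T → S ⊆ T := by
    intro S hS T hT h P hP
    obtain ⟨e, he⟩ := Setoid.nonempty_of_mem_partition hc (hS hP)
    exact hc.mem_of_mem_sUnion hT (hS hP) he (h ▸ ⟨P, hP, he⟩)
  exact fun S hS T hT h => (key S hS T hT h).antisymm (key T hT S hS h.symm)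

end Setoid.IsPartition

/-! ### The active partition and its unions -/

namespace OrientedMatroid

variable {E : Type*} [LinearOrder E] (M : OrientedMatroid E)

theorem mem_activeElements {a : E} : a ∈ M.activeElements ↔ a ∈ M.circuitUnionGE a :=
  ⟨fun ⟨C, hC, ha⟩ => ⟨C, ⟨hC, ha.2⟩, ha.1⟩, fun ⟨C, hC, ha⟩ => ⟨C, hC.1, ha, hC.2⟩⟩

/-- The part of the active partition with minimum the active element `a`. -/
def activePart (a : E) : Set E :=
  {e | e ∈ M.circuitUnionGE a ∧ ∀ b ∈ M.activeElements, a < b → e ∉ M.circuitUnionGE b}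

theorem mem_activePart_self {a : E} (ha : a ∈ M.activeElements) : a ∈ M.activePart a :=
  ⟨M.mem_activeElements.1 ha, fun _ _ hb h => hb.not_ge (le_of_mem_circuitUnionGE h)⟩

theorem injOn_activePart : Set.InjOn M.activePart M.activeElements := by
  intro a ha b hb h
  have h1 := M.mem_activePart_self ha
  have h2 := M.mem_activePart_self hb
  rw [h] at h1
  rw [← h] at h2
  exact le_antisymm (le_of_mem_circuitUnionGE h2.1) (le_of_mem_circuitUnionGE h1.1)

theorem eq_of_mem_activePart {a b e : E} (ha : a ∈ M.activeElements) (hb : b ∈ M.activeElements)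
    (hea : e ∈ M.activePart a) (heb : e ∈ M.activePart b) : a = b := by
  rcases lt_trichotomy a b with h | h | h
  · exact absurd heb.1 (hea.2 b hb h)
  · exact h
  · exact absurd hea.1 (heb.2 a ha h)

variable [Fintype E]

theorem IsPositiveCircuit.exists_mem_activeElements {M : OrientedMatroid E} {C : Set E}
    (hC : M.IsPositiveCircuit C) {e : E} (he : e ∈ C) :
    ∃ a ∈ M.activeElements, e ∈ M.circuitUnionGE a := by
  obtain ⟨a, ha, hmin⟩ := Set.exists_min_image C id (Set.toFinite C) ⟨e, he⟩
  exact ⟨a, ⟨C, hC, ha, hmin⟩, C, ⟨hC, hmin⟩, he⟩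

theorem IsPositiveCircuit.exists_mem_activePart {M : OrientedMatroid E} {C : Set E}
    (hC : M.IsPositiveCircuit C) {e : E} (he : e ∈ C) :
    ∃ a ∈ M.activeElements, e ∈ M.activePart a := by
  obtain ⟨a₀, ha₀, he₀⟩ := hC.exists_mem_activeElements he
  obtain ⟨a, ⟨ha, hea⟩, hmax⟩ := Set.exists_max_image
    {a | a ∈ M.activeElements ∧ e ∈ M.circuitUnionGE a} id (Set.toFinite _) ⟨a₀, ha₀, he₀⟩
  exact ⟨a, ha, hea, fun b hb hab heb => hab.not_ge (hmax b ⟨hb, heb⟩)⟩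

/-- Take `b` to be the next active element, if there is one. The symmetric difference form turns
reorienting a part into two successive reorientations. -/
theorem activePart_eq_symmDiff (a : E) :
    M.activePart a = M.circuitUnionGE a ∨
      ∃ b, M.activePart a = symmDiff (M.circuitUnionGE a) (M.circuitUnionGE b) := by
  by_cases h : ∃ b ∈ M.activeElements, a < b
  · obtain ⟨b, ⟨hb, hab⟩, hmin⟩ := Set.exists_min_image {b | b ∈ M.activeElements ∧ a < b} id
      (Set.toFinite _) h
    refine Or.inr ⟨b, Set.ext fun e => ?_⟩
    rw [symmDiff_of_ge (M.circuitUnionGE_anti hab.le)]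
    exact and_congr_right fun _ => ⟨fun he => he b hb hab,
      fun he c hc hac hec => he (M.circuitUnionGE_anti (hmin c ⟨hc, hac⟩) hec)⟩
  · refine Or.inl (Set.ext fun e => ⟨And.left, fun he => ⟨he, fun b hb hab => ?_⟩⟩)
    exact absurd ⟨b, hb, hab⟩ h

theorem activePartition_eq :
    M.activePartition = M.activePart '' M.activeElements ∪
      M.dual.activePart '' M.dual.activeElements := by
  have key : ∀ (N : OrientedMatroid E) (P : Set E),
      (∃ a ∈ sortedElements N.activeElements, P = {e | e ∈ N.circuitUnionGE a ∧
        ∀ b ∈ sortedElements N.activeElements, a < b → e ∉ N.circuitUnionGE b}) ↔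
      P ∈ N.activePart '' N.activeElements := by
    intro N P
    simp only [mem_sortedElements, Set.mem_image, activePart, eq_comm]
  -- Complementation reverses differences, so the upper list reduces to the lower list of the dual.
  have hupper : M.activeFiltration.upper =
      ((sortedElements M.dual.activeElements).map M.dual.circuitUnionGE ++ [∅]).map compl := by
    simp only [List.map_append, List.map_map, List.map_singleton, Set.compl_empty]
    rfl
  ext P
  refine or_congr ?_ ?_
  · rw [← key, ← exists_consecutive_diff_iff (fun a b h => M.circuitUnionGE_anti h)
      (pairwise_sortedElements _)]
    rfl
  · rw [← key, ← exists_consecutive_diff_iff (fun a b h => M.dual.circuitUnionGE_anti h)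
      (pairwise_sortedElements _), hupper]
    simp only [List.getElem?_map, Option.map_eq_some_iff]
    constructor
    · rintro ⟨k, _, _, ⟨F, hF, rfl⟩, ⟨G, hG, rfl⟩, rfl⟩
      exact ⟨k, F, G, hF, hG, by rw [Set.sdiff_eq, Set.sdiff_eq, compl_compl, Set.inter_comm]⟩
    · rintro ⟨k, F, G, hF, hG, rfl⟩
      exact ⟨k, _, _, ⟨F, hF, rfl⟩, ⟨G, hG, rfl⟩,
        by rw [Set.sdiff_eq, Set.sdiff_eq, compl_compl, Set.inter_comm]⟩

theorem notMem_dual_activePart {a b e : E} (he : e ∈ M.activePart a) :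
    e ∉ M.dual.activePart b := fun h => by
  obtain ⟨C, hC, heC⟩ := he.1
  exact M.notMem_circuitUnionGE_of_dual hC.1 heC h.1

theorem isPartition_activePartition : Setoid.IsPartition M.activePartition := by
  rw [activePartition_eq]
  constructor
  · rintro (⟨a, ha, h⟩ | ⟨a, ha, h⟩)
    · exact Set.notMem_empty a (h ▸ M.mem_activePart_self ha)
    · exact Set.notMem_empty a (h ▸ M.dual.mem_activePart_self ha)
  · intro e
    rcases M.exists_isPositiveCircuit_or_isPositiveCocircuit e with ⟨C, hC, he⟩ | ⟨D, hD, he⟩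
    · obtain ⟨a, ha, hea⟩ := hC.exists_mem_activePart he
      refine ⟨_, ⟨Or.inl ⟨a, ha, rfl⟩, hea⟩, ?_⟩
      rintro _ ⟨⟨b, hb, rfl⟩ | ⟨b, hb, rfl⟩, heb⟩
      · rw [M.eq_of_mem_activePart ha hb hea heb]
      · exact absurd heb (M.notMem_dual_activePart hea)
    · obtain ⟨a, ha, hea⟩ := IsPositiveCircuit.exists_mem_activePart (M := M.dual) hD he
      refine ⟨_, ⟨Or.inr ⟨a, ha, rfl⟩, hea⟩, ?_⟩
      rintro _ ⟨⟨b, hb, rfl⟩ | ⟨b, hb, rfl⟩, heb⟩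
      · exact absurd hea (M.notMem_dual_activePart heb)
      · rw [M.dual.eq_of_mem_activePart ha hb hea heb]

theorem ncard_activePartition :
    M.activePartition.ncard = M.dualActiveElements.ncard + M.activeElements.ncard := by
  rw [activePartition_eq, Set.ncard_union_eq, M.injOn_activePart.ncard_image,
    M.dual.injOn_activePart.ncard_image, add_comm]
  · rfl
  · rw [Set.disjoint_left]
    rintro _ ⟨a, ha, rfl⟩ ⟨b, hb, h⟩
    exact M.notMem_dual_activePart (M.mem_activePart_self ha) (h ▸ M.mem_activePart_self ha)

theorem activeUnions_eq_image : M.activeUnions = Set.sUnion '' 𝒫 M.activePartition := by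
  ext A
  exact ⟨fun ⟨S, hS, h⟩ => ⟨S, hS, h.symm⟩, fun ⟨S, hS, h⟩ => ⟨S, hS, h.symm⟩⟩

theorem ncard_activeUnions :
    M.activeUnions.ncard = 2 ^ (M.dualActiveElements.ncard + M.activeElements.ncard) := by
  rw [activeUnions_eq_image, M.isPartition_activePartition.injOn_sUnion.ncard_image,
    Set.ncard_powerset, ncard_activePartition]

theorem empty_mem_activeUnions : ∅ ∈ M.activeUnions :=
  ⟨∅, Set.empty_subset _, Set.sUnion_empty.symm⟩

theorem symmDiff_mem_activeUnions {A B : Set E} (hA : A ∈ M.activeUnions)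
    (hB : B ∈ M.activeUnions) : symmDiff A B ∈ M.activeUnions := by
  obtain ⟨S, hS, rfl⟩ := hA
  obtain ⟨T, hT, rfl⟩ := hB
  exact ⟨symmDiff S T, fun Q hQ => hQ.elim (fun h => hS h.1) fun h => hT h.1,
    (M.isPartition_activePartition.sUnion_symmDiff hS hT).symm⟩

variable {M} in
-- The union taken in `M` is also the one taken in `M.reorient A`, so single-step invariance applies
-- there.
theorem SameUnions.symmDiff_circuitUnionGE {A : Set E} (h : SameUnions (M.reorient A) M) (a : E) :
    SameUnions (M.reorient (symmDiff A (M.circuitUnionGE a))) M := by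
  rw [← reorient_reorient, ← h.1]
  exact (sameUnions_reorient _ a).trans h

variable {M} in
theorem SameUnions.symmDiff_dual_circuitUnionGE {A : Set E} (h : SameUnions (M.reorient A) M)
    (a : E) : SameUnions (M.reorient (symmDiff A (M.dual.circuitUnionGE a))) M := by
  rw [← reorient_reorient, ← h.2]
  exact (sameUnions_reorient_dual _ a).trans h

variable {M} in
theorem SameUnions.symmDiff_of_mem_activePartition {A P : Set E}
    (h : SameUnions (M.reorient A) M) (hP : P ∈ M.activePartition) :
    SameUnions (M.reorient (symmDiff A P)) M := by
  rw [activePartition_eq] at hP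
  rcases hP with ⟨a, -, rfl⟩ | ⟨a, -, rfl⟩
  · rcases M.activePart_eq_symmDiff a with h' | ⟨b, h'⟩
    · rw [h']
      exact h.symmDiff_circuitUnionGE a
    · rw [h', ← symmDiff_assoc]
      exact (h.symmDiff_circuitUnionGE a).symmDiff_circuitUnionGE b
  · rcases M.dual.activePart_eq_symmDiff a with h' | ⟨b, h'⟩
    · rw [h']
      exact h.symmDiff_dual_circuitUnionGE a
    · rw [h', ← symmDiff_assoc]
      exact (h.symmDiff_dual_circuitUnionGE a).symmDiff_dual_circuitUnionGE b

theorem sameUnions_of_mem_activeUnions {A : Set E} (hA : A ∈ M.activeUnions) :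
    SameUnions (M.reorient A) M := by
  obtain ⟨S, hS, rfl⟩ := hA
  induction S, Set.toFinite S using Set.Finite.induction_on with
  | empty =>
    rw [Set.sUnion_empty, reorient_empty]
    exact ⟨rfl, rfl⟩
  | @insert P S hPS _ ih =>
    rw [Set.insert_subset_iff] at hS
    have hins : insert P S = symmDiff S {P} := by
      rw [(Set.disjoint_singleton_right.2 hPS).symmDiff_eq_sup, Set.insert_eq, Set.union_comm]
      rfl
    have : ⋃₀ insert P S = symmDiff (⋃₀ S) P := by
      rw [hins, M.isPartition_activePartition.sUnion_symmDiff hS.2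
        (Set.singleton_subset_iff.2 hS.1), Set.sUnion_singleton]
    rw [this]
    exact (ih hS.2).symmDiff_of_mem_activePartition hS.1

variable {M} in
theorem SameUnions.activeElements_eq {N : OrientedMatroid E} (h : SameUnions M N) :
    M.activeElements = N.activeElements := by
  ext a
  rw [mem_activeElements, mem_activeElements, h.1]

variable {M} in
theorem SameUnions.dualActiveElements_eq {N : OrientedMatroid E} (h : SameUnions M N) :
    M.dualActiveElements = N.dualActiveElements := by
  ext a
  change a ∈ M.dual.activeElements ↔ a ∈ N.dual.activeElements
  rw [mem_activeElements, mem_activeElements, h.2]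

/-- Expresses the cyclic flat through the bounded unions, so that `SameUnions` determines it. -/
theorem sUnion_isPositiveCircuit_eq :
    ⋃₀ {C | M.IsPositiveCircuit C} = ⋃ a, M.circuitUnionGE a := by
  ext e
  rw [Set.mem_iUnion]
  constructor
  · rintro ⟨C, hC, he⟩
    obtain ⟨a, -, ha⟩ := IsPositiveCircuit.exists_mem_activeElements hC he
    exact ⟨a, ha⟩
  · rintro ⟨a, C, hC, he⟩
    exact ⟨C, hC.1, he⟩

variable {M} in
theorem SameUnions.activeFiltration_eq {N : OrientedMatroid E} (h : SameUnions M N) :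
    M.activeFiltration = N.activeFiltration := by
  have h2 : M.cocircuitUnionGE = N.cocircuitUnionGE := h.2
  ext1
  · simp only [activeFiltration, h.activeElements_eq, h.1]
  · simp only [activeFiltration, sUnion_isPositiveCircuit_eq, h.1]
  · simp only [activeFiltration, h.dualActiveElements_eq, h2]

variable {M} in
theorem SameUnions.activePartition_eq {N : OrientedMatroid E} (h : SameUnions M N) :
    M.activePartition = N.activePartition := by
  simp only [activePartition, h.activeFiltration_eq]

variable {M} in
theorem SameUnions.activeUnions_eq {N : OrientedMatroid E} (h : SameUnions M N) :
    M.activeUnions = N.activeUnions := by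
  simp only [activeUnions, h.activePartition_eq]

/-! ### Activity classes -/

theorem mem_activityClass_self (A : Set E) : A ∈ M.activityClass A :=
  ⟨∅, empty_mem_activeUnions _, (symmDiff_bot A).symm⟩

/-- Both reorientations have the same unions of parts, and these are closed under symmetric
difference, so the two classes are the same coset. -/
theorem activityClass_eq_of_mem {A A' : Set E} (h : A' ∈ M.activityClass A) :
    M.activityClass A' = M.activityClass A := by
  obtain ⟨B, hB, rfl⟩ := h
  have hU : (M.reorient (symmDiff A B)).activeUnions = (M.reorient A).activeUnions := by
    rw [← reorient_reorient]
    exact (sameUnions_of_mem_activeUnions _ hB).activeUnions_eq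
  ext A'
  constructor
  · rintro ⟨B', hB', rfl⟩
    rw [hU] at hB'
    exact ⟨symmDiff B B', symmDiff_mem_activeUnions _ hB hB', symmDiff_assoc A B B'⟩
  · rintro ⟨B', hB', rfl⟩
    refine ⟨symmDiff B B', hU ▸ symmDiff_mem_activeUnions _ hB hB', ?_⟩
    rw [symmDiff_assoc, symmDiff_symmDiff_cancel_left]

end OrientedMatroid

theorem proposition4p8 {E : Type*} [Fintype E] [LinearOrder E] (M : OrientedMatroid E) :
    -- the parts of the active partition of `M` do partition `E`
    Setoid.IsPartition M.activePartition ∧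
    -- there are `2 ^ (ι + ε)` reorientations obtained by reorienting unions of parts
    M.activeUnions.ncard = 2 ^ (M.dualActiveElements.ncard + M.activeElements.ncard) ∧
    -- all of them have the same active filtration, partition and (dual-)active elements as `M`
    (∀ A ∈ M.activeUnions,
      (M.reorient A).activeFiltration = M.activeFiltration ∧
      (M.reorient A).activePartition = M.activePartition ∧
      (M.reorient A).activeElements = M.activeElements ∧
      (M.reorient A).dualActiveElements = M.dualActiveElements) ∧
    -- the activity classes partition the set of reorientations of `M`
    Setoid.IsPartition (Set.range fun A : Set E => M.activityClass A) := by
  refine ⟨M.isPartition_activePartition, M.ncard_activeUnions, fun A hA => ?_, ?_, fun A => ?_⟩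
  · have h := M.sameUnions_of_mem_activeUnions hA
    exact ⟨h.activeFiltration_eq, h.activePartition_eq, h.activeElements_eq,
      h.dualActiveElements_eq⟩
  · rintro ⟨A, hA⟩
    exact Set.notMem_empty A (hA ▸ M.mem_activityClass_self A)
  · refine ⟨_, ⟨⟨A, rfl⟩, M.mem_activityClass_self A⟩, ?_⟩
    rintro _ ⟨⟨A', rfl⟩, hA⟩
    exact (M.activityClass_eq_of_mem hA).symm
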